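/- Let $k$ be a field of characteristic $0$. All graded objects are $\mathbb Z$-graded with cohomological grading, and "free", "complete" are understood degreewise. For a graded Lie algebra $\mathfrak g$ let $F_n\mathfrak g$ be the span of all iterated brackets of at least $n$ elements; $\mathfrak g$ is complete if $\mathfrak g\to\varprojlim_n \mathfrak g/F_n\mathfrak g$ is an isomorphism. $\widehat{Lie}(V)$ denotes the free complete graded Lie algebra on a finite dimensional graded vector space $V$. A Maurer–Cartan element of a dg Lie algebra is an element $\alpha$ of degree $1$ with $d\alpha+\tfrac12[\alpha,\alpha]=0$. In a complete dg Lie algebra, an element $\lambda$ of degree $0$ is a gauge from $\alpha_0$ to $\alpha_1$ if the solution $\alpha(t)\in\varprojlim_n(\mathfrak g/F_n\mathfrak g)[t]$ of $\dot\alpha(t)=d\lambda-[\lambda,\alpha(t)]$, $\alpha(0)=\alpha_0$, satisfies $\alpha(1)=\alpha_1$. Let $\Omega_0=k$ and $\Omega_1=k[t_0,t_1,dt_0,dt_1]/(t_0+t_1-1,\ dt_0+dt_1)$ be the commutative dg algebras of polynomial differential forms on the point and on the interval. Let $C_0=k$ and let $C_1\subset\Omega_1$ be the subcomplex spanned by $\omega_0=t_0$,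 $\omega_1=t_1$, $\omega_{01}=t_0\,dt_1-t_1\,dt_0$. Let $(i_n,p_n,h_n)$ be Dupont's contraction of $\Omega_n$ onto $C_n$: for $n=0$ both $i_0,p_0$ are identities and $h_0=0$; for $n=1$, with $t=t_1$, $i_1$ is the inclusion, $p_1(f+g\,dt)=f(0)\,\omega_0+f(1)\,\omega_1+\big(\int_0^1 g\big)\,\omega_{01}$ and $h_1(f+g\,dt)=\int_0^t g-t\int_0^1 g$. Transferring the commutative algebra structure of $\Omega_n$ along this contraction (sum over binary trees) gives a $\mathcal C_\infty$-algebra structure on $C_n$, and $\mathfrak{mc}_n$ is the complete cobar construction of the dual coalgebra: $\mathfrak{mc}_n=\widehat{Lie}(sC_n^\vee)$, with generators $x_i=s e_i^\vee$ of degree $1-|e_i|$ dual to the basis $(e_i)$ of $C_n$, and with $d$ the unique derivation of degree $1$ such that the element $\kappa=\sum_i x_i\otimes e_i$ satisfies $$\sum_i dx_i\otimes e_i+(1\otimes d_{C_n})\kappa+(1\otimes p_n)\big(\tfrac12[\psi,\psi]\big)=0,\qquad \psi=(1\otimes i_n)\kappa-(1\otimes h_n)\big(\tfrac12[\psi,\psi]\big),$$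 where $\psi$ is the solution, obtained by iteration, in the completed tensor product of $\mathfrak{mc}_n$ and $\Omega_n$. Then: 1. $\mathfrak{mc}_0$ is the free complete dg Lie algebra on a single Maurer–Cartan generator: $d^2=0$, it is free as a complete graded Lie algebra on the element $\alpha=s1^\vee$ of degree $1$, and $\alpha$ is a Maurer–Cartan element. For any complete dg Lie algebra $L$ which is free as a complete graded Lie algebra on a single Maurer–Cartan element $a$, there is an isomorphism of dg Lie algebras $\mathfrak{mc}_0\cong L$ mapping $\alpha$ to $a$. 2. $\mathfrak{mc}_1$ is the Lawrence–Sullivan algebra: $d^2=0$, it is free as a complete graded Lie algebra on $\alpha_0=s\omega_0^\vee$, $\alpha_1=s\omega_1^\vee$ of degree $1$ and $\lambda=s\omega_{01}^\vee$ of degree $0$, the elements $\alpha_0,\alpha_1$ are Maurer–Cartan elements, and $\lambda$ is a gauge from $\alpha_0$ to $\alpha_1$. For any complete dg Lie algebra $L$ which is free as a complete graded Lie algebra on two Maurer–Cartan elements $a,b$ of degree $1$ and an element $x$ of degree $0$ which is a gauge from $a$ to $b$, there is an isomorphism of dg Lie algebras $\mathfrak{mc}_1\cong L$ mapping $\alpha_0,\alpha_1,\lambda$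 to $a,b,x$. -/

import Mathlib

universe u

namespace LieMC

/-! ## Graded Lie algebras -/

/-- The sign `(-1)^n` as a scalar. -/
def sgn (k : Type u) [Field k] (n : ℤ) : k := ((Int.negOnePow n : ℤ) : k)

theorem sgn_add (k : Type u) [Field k] (m n : ℤ) : sgn k (m + n) = sgn k m * sgn k n := by
  simp [sgn, Int.negOnePow_add]

theorem sgn_eq (k : Type u) [Field k] (n : ℤ) : sgn k n = 1 ∨ sgn k n = -1 := by
  rcases Int.even_or_odd n with h | h
  · left; simp [sgn, Int.negOnePow_even n h]
  · right; simp [sgn, Int.negOnePow_odd n h]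

theorem sgn_mul_self (k : Type u) [Field k] (n : ℤ) : sgn k n * sgn k n = 1 := by
  rcases sgn_eq k n with h | h <;> simp [h]

@[simp] theorem sgn_one (k : Type u) [Field k] : sgn k 1 = -1 := by simp [sgn]

@[simp] theorem sgn_zero (k : Type u) [Field k] : sgn k 0 = 1 := by simp [sgn]

/-- A `ℤ`-graded Lie algebra over `k` (used in characteristic `0`), given by its homogeneous
components. The degree of a bracket is carried as an equation `p + q = r`, which avoids casts. -/
structure GradedLie (k : Type u) [Field k] where
  /-- the homogeneous components -/
  V : ℤ → Type u
  [addCommGroup : ∀ p, AddCommGroup (V p)]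
  [module : ∀ p, Module k (V p)]
  /-- the bracket -/
  bracket : ∀ {p q r : ℤ}, p + q = r → V p →ₗ[k] V q →ₗ[k] V r
  antisymm : ∀ {p q r : ℤ} (h : p + q = r) (h' : q + p = r) (x : V p) (y : V q),
    bracket h x y = -(sgn k (p * q) • bracket h' y x)
  jacobi : ∀ {p q r qr pq pr t : ℤ} (h₁ : q + r = qr) (h₂ : p + qr = t) (h₃ : p + q = pq)
    (h₄ : pq + r = t) (h₅ : p + r = pr) (h₆ : q + pr = t) (x : V p) (y : V q) (z : V r),
    bracket h₂ x (bracket h₁ y z) =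
      bracket h₄ (bracket h₃ x y) z + sgn k (p * q) • bracket h₆ y (bracket h₅ x z)

attribute [instance] GradedLie.addCommGroup GradedLie.module

namespace GradedLie

variable {k : Type u} [Field k]

/-- `L.IsBracketing n x` : the element `x` is obtained as an iterated bracketing (in any
arrangement) of `n ≥ 1` homogeneous elements of `L`. -/
inductive IsBracketing (L : GradedLie k) : ℕ → ∀ {p : ℤ}, L.V p → Prop
  | elem {p : ℤ} (x : L.V p) : IsBracketing L 1 x
  | bracket {m n : ℕ} {p q r : ℤ} (h : p + q = r) {x : L.V p} {y : L.V q}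
      (hx : IsBracketing L m x) (hy : IsBracketing L n y) :
      IsBracketing L (m + n) (L.bracket h x y)

/-- The degree `p` part of the canonical filtration `F_n L`: the span of all bracketings of at
least `n` elements. -/
def F (L : GradedLie k) (n : ℕ) (p : ℤ) : Submodule k (L.V p) :=
  Submodule.span k {x | ∃ m, n ≤ m ∧ L.IsBracketing m x}

/-- `L` is complete: the canonical map `L → lim_n L / F_n L` is injective and surjective in every
degree. A point of the limit is represented by a sequence whose consecutive terms agree
modulo `F_n L`. -/
def IsComplete (L : GradedLie k) : Prop :=
  ∀ p : ℤ, (∀ x : L.V p, (∀ n, x ∈ L.F n p) → x = 0) ∧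
    ∀ s : ℕ → L.V p, (∀ n, s (n + 1) - s n ∈ L.F n p) → ∃ x, ∀ n, x - s n ∈ L.F n p

/-- Morphisms of graded Lie algebras (of degree `0`). -/
@[ext] structure Hom (L M : GradedLie k) where
  /-- the components -/
  f : ∀ p, L.V p →ₗ[k] M.V p
  map_bracket : ∀ {p q r : ℤ} (h : p + q = r) (x : L.V p) (y : L.V q),
    f r (L.bracket h x y) = M.bracket h (f p x) (f q y)

/-- `L` is the free complete graded Lie algebra on the homogeneous elements `g i` of degree
`deg i`: it is complete, and every assignment of the `g i` to elements of the same degrees in a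
complete graded Lie algebra extends uniquely to a morphism. -/
def IsFreeCompleteOn (L : GradedLie k) {I : Type} (deg : I → ℤ) (g : ∀ i, L.V (deg i)) : Prop :=
  L.IsComplete ∧ ∀ (M : GradedLie k), M.IsComplete → ∀ y : ∀ i, M.V (deg i),
    ∃! φ : Hom L M, ∀ i, φ.f (deg i) (g i) = y i

end GradedLie

/-- A graded Lie algebra with a derivation of degree `1`. -/
structure DerLie (k : Type u) [Field k] extends GradedLie k where
  /-- the derivation -/
  d : ∀ {p q : ℤ}, p + 1 = q → V p →ₗ[k] V q
  leibniz : ∀ {p q r p' q' t : ℤ} (h : p + q = r) (hr : r + 1 = t) (hp : p + 1 = p')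
    (h₁ : p' + q = t) (hq : q + 1 = q') (h₂ : p + q' = t) (x : V p) (y : V q),
    d hr (bracket h x y) = bracket h₁ (d hp x) y + sgn k p • bracket h₂ x (d hq y)

namespace DerLie

variable {k : Type u} [Field k]

/-- `L` is a dg Lie algebra: its derivation squares to zero. -/
def IsDGLie (L : DerLie k) : Prop :=
  ∀ {p q r : ℤ} (h : p + 1 = q) (h' : q + 1 = r) (x : L.V p), L.d h' (L.d h x) = 0

/-- Isomorphisms: bijective morphisms of graded Lie algebras that commute with the
differentials. -/
structure Iso (L M : DerLie k) extends GradedLie.Hom L.toGradedLie M.toGradedLie where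
  bijective : ∀ p, Function.Bijective (f p)
  map_d : ∀ {p q : ℤ} (h : p + 1 = q) (x : L.V p), f q (L.d h x) = M.d h (f p x)

/-- Maurer--Cartan elements: `dα + ½[α, α] = 0` with `α` of degree `1`. -/
def IsMaurerCartan (L : DerLie k) (α : L.V 1) : Prop :=
  L.d (q := 2) (by norm_num) α + (2 : k)⁻¹ • L.bracket (r := 2) (by norm_num) α α = 0

/-- The degree `0` element `x` is a gauge from `a` to `b`: the flow
`α'(t) = dx - [x, α(t)] = dx + [α(t), x]`, `α(0) = a`, satisfies `α(1) = b`.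
Here `α(t) = ∑ₙ cₙ tⁿ` is a power series whose coefficients tend to zero for the canonical
filtration, i.e. an element of `lim_N (L / F_N L)[t]`, and `α(1) = ∑ₙ cₙ`. -/
def IsGauge (L : DerLie k) (x : L.V 0) (a b : L.V 1) : Prop :=
  ∃ c : ℕ → L.V 1, c 0 = a ∧
    (∀ n : ℕ, ((n + 1 : ℕ) : k) • c (n + 1) =
      (if n = 0 then L.d (by norm_num) x else 0) - L.bracket (by norm_num) x (c n)) ∧
    (∀ N : ℕ, ∃ K : ℕ, ∀ n ≥ K, c n ∈ L.F N 1) ∧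
    (∀ N : ℕ, ∃ K : ℕ, ∀ n ≥ K, (∑ m ∈ Finset.range n, c m) - b ∈ L.F N 1)

/-- `L` is a complete dg Lie algebra, free as a complete graded Lie algebra on the single
element `a` of degree `1`, and `a` is a Maurer--Cartan element. -/
def IsFreeOnMaurerCartan (L : DerLie k) (a : L.V 1) : Prop :=
  L.IsDGLie ∧ L.IsFreeCompleteOn (I := Unit) (fun _ => 1) (fun _ => a) ∧ L.IsMaurerCartan a

/-- The three generators of a Lawrence--Sullivan algebra. -/
inductive LSGen
  | a | b | x

/-- The degrees of the three generators. -/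
def LSGen.deg : LSGen → ℤ
  | .a => 1
  | .b => 1
  | .x => 0

/-- The three elements `a`, `b`, `x` as a family. -/
def lsFamily (L : DerLie k) (a b : L.V 1) (x : L.V 0) : ∀ i : LSGen, L.V i.deg
  | .a => a
  | .b => b
  | .x => x

/-- `L` is a Lawrence--Sullivan algebra with generators `a`, `b`, `x`: a complete dg Lie algebra,
free as a complete graded Lie algebra on `a`, `b` of degree `1` and `x` of degree `0`, such that
`a` and `b` are Maurer--Cartan elements and `x` is a gauge from `a` to `b`. -/
def IsLawrenceSullivan (L : DerLie k) (a b : L.V 1) (x : L.V 0) : Prop :=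
  L.IsDGLie ∧ L.IsFreeCompleteOn LSGen.deg (L.lsFamily a b x) ∧
    L.IsMaurerCartan a ∧ L.IsMaurerCartan b ∧ L.IsGauge x a b

end DerLie

/-! ## The free complete graded Lie algebra with a derivation

Noncommutative power series in the generators are represented as power series in an auxiliary
variable counting the word length, with coefficients in the free associative algebra. -/

section Free

variable {k : Type u} [Field k] {I : Type} (deg : I → ℤ)

/-- The total degree of a bracketing of generators. -/
def treeDeg : FreeMagma I → ℤ
  | .of i => deg i
  | .mul s t => treeDeg s + treeDeg t

@[simp] theorem treeDeg_of (i : I) : treeDeg deg (.of i) = deg i := rfl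

@[simp] theorem treeDeg_mul (s t : FreeMagma I) :
    treeDeg deg (s * t) = treeDeg deg s + treeDeg deg t := rfl

variable (k) in
/-- The value of a bracketing of generators in the free associative algebra, for the graded
commutator. -/
def treeLie : FreeMagma I → FreeAlgebra k I
  | .of i => FreeAlgebra.ι k i
  | .mul s t => treeLie s * treeLie t -
      sgn k (treeDeg deg s * treeDeg deg t) • (treeLie t * treeLie s)

@[simp] theorem treeLie_of (i : I) : treeLie k deg (.of i) = FreeAlgebra.ι k i := rfl

@[simp] theorem treeLie_mul (s t : FreeMagma I) :
    treeLie k deg (s * t) = treeLie k deg s * treeLie k deg t -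
      sgn k (treeDeg deg s * treeDeg deg t) • (treeLie k deg t * treeLie k deg s) := rfl

variable (k) in
/-- The Lie polynomials of word length `n` and degree `p`: the span of the bracketings of `n`
generators of total degree `p`. -/
def liePoly (n : ℕ) (p : ℤ) : Submodule k (FreeAlgebra k I) :=
  Submodule.span k {a | ∃ t : FreeMagma I, t.length = n ∧ treeDeg deg t = p ∧ treeLie k deg t = a}

theorem liePoly_zero (p : ℤ) : liePoly k deg 0 p = ⊥ := by
  rw [liePoly, Submodule.span_eq_bot]
  rintro a ⟨t, h, -, -⟩
  exact absurd h t.length_pos.ne'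

theorem liePoly_bracket {n m : ℕ} {p q : ℤ} {a b : FreeAlgebra k I}
    (ha : a ∈ liePoly k deg n p) (hb : b ∈ liePoly k deg m q) :
    a * b - sgn k (p * q) • (b * a) ∈ liePoly k deg (n + m) (p + q) := by
  induction ha using Submodule.span_induction with
  | zero => simp
  | add x y _ _ hx hy =>
    have : (x + y) * b - sgn k (p * q) • (b * (x + y)) =
      (x * b - sgn k (p * q) • (b * x)) + (y * b - sgn k (p * q) • (b * y)) := by
      rw [add_mul, mul_add, smul_add]; abel
    rw [this]; exact add_mem hx hy
  | smul c x _ hx =>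
    have : (c • x) * b - sgn k (p * q) • (b * (c • x)) =
      c • (x * b - sgn k (p * q) • (b * x)) := by
      rw [smul_mul_assoc, mul_smul_comm, smul_sub, smul_comm c]
    rw [this]; exact Submodule.smul_mem _ _ hx
  | mem x hx =>
    obtain ⟨s, rfl, rfl, rfl⟩ := hx
    induction hb using Submodule.span_induction with
    | zero => simp
    | add y z _ _ hy hz =>
      have : treeLie k deg s * (y + z) - sgn k (treeDeg deg s * q) • ((y + z) * treeLie k deg s) =
        (treeLie k deg s * y - sgn k (treeDeg deg s * q) • (y * treeLie k deg s)) +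
        (treeLie k deg s * z - sgn k (treeDeg deg s * q) • (z * treeLie k deg s)) := by
        rw [add_mul, mul_add, smul_add]; abel
      rw [this]; exact add_mem hy hz
    | smul c y _ hy =>
      have : treeLie k deg s * (c • y) - sgn k (treeDeg deg s * q) • ((c • y) * treeLie k deg s) =
        c • (treeLie k deg s * y - sgn k (treeDeg deg s * q) • (y * treeLie k deg s)) := by
        rw [smul_mul_assoc, mul_smul_comm, smul_sub, smul_comm c]
      rw [this]; exact Submodule.smul_mem _ _ hy
    | mem y hy =>
      obtain ⟨t, rfl, rfl, rfl⟩ := hy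
      exact Submodule.subset_span ⟨s * t, rfl, rfl, rfl⟩

variable (k) in
/-- The degree `p` component of the free complete graded Lie algebra: the product over all `n` of
the Lie polynomials of length `n` and degree `p`. -/
def lieHat (p : ℤ) : Submodule k (PowerSeries (FreeAlgebra k I)) where
  carrier := {F | ∀ n, PowerSeries.coeff n F ∈ liePoly k deg n p}
  zero_mem' n := by simp
  add_mem' hF hG n := by rw [map_add]; exact add_mem (hF n) (hG n)
  smul_mem' c F hF n := Submodule.smul_mem _ c (hF n)

theorem mem_lieHat {p : ℤ} {F : PowerSeries (FreeAlgebra k I)} :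
    F ∈ lieHat k deg p ↔ ∀ n, PowerSeries.coeff n F ∈ liePoly k deg n p := Iff.rfl

theorem coeff_smul' (c : k) (n : ℕ) (F : PowerSeries (FreeAlgebra k I)) :
    PowerSeries.coeff n (c • F) = c • PowerSeries.coeff n F := rfl

theorem lieHat_bracket {p q : ℤ} {F G : PowerSeries (FreeAlgebra k I)}
    (hF : F ∈ lieHat k deg p) (hG : G ∈ lieHat k deg q) :
    F * G - sgn k (p * q) • (G * F) ∈ lieHat k deg (p + q) := by
  intro n
  rw [map_sub, coeff_smul', PowerSeries.coeff_mul, PowerSeries.coeff_mul,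
    ← Finset.Nat.sum_antidiagonal_swap, Finset.smul_sum, ← Finset.sum_sub_distrib]
  refine Submodule.sum_mem _ fun ij hij => ?_
  obtain rfl := Finset.HasAntidiagonal.mem_antidiagonal.1 hij
  have := liePoly_bracket deg (hF ij.2) (hG ij.1)
  rw [add_comm ij.2 ij.1] at this
  exact this

variable (k) in
/-- The free complete graded Lie algebra on generators of degrees `deg i`, inside the
noncommutative power series with the graded commutator. -/
noncomputable def freeLie : GradedLie k where
  V p := lieHat k deg p
  bracket {p q r} h := LinearMap.mk₂ k
    (fun F G => ⟨F.1 * G.1 - sgn k (p * q) • (G.1 * F.1), h ▸ lieHat_bracket deg F.2 G.2⟩)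
    (fun F F' G => Subtype.ext <| by
      simp only [Submodule.coe_add, add_mul, mul_add, smul_add]; abel)
    (fun c F G => Subtype.ext <| by
      simp only [Submodule.coe_smul, smul_mul_assoc, mul_smul_comm, smul_sub]
      rw [smul_comm c])
    (fun F G G' => Subtype.ext <| by
      simp only [Submodule.coe_add, add_mul, mul_add, smul_add]; abel)
    (fun c F G => Subtype.ext <| by
      simp only [Submodule.coe_smul, smul_mul_assoc, mul_smul_comm, smul_sub]
      rw [smul_comm c])
  antisymm {p q r} h h' F G := Subtype.ext <| by
    simp only [LinearMap.mk₂_apply, Submodule.coe_neg, Submodule.coe_smul, mul_comm q p, smul_sub,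
      smul_smul, sgn_mul_self, one_smul]
    abel
  jacobi {p q r qr pq pr t} h₁ h₂ h₃ h₄ h₅ h₆ F G H := Subtype.ext <| by
    subst h₁ h₃ h₅
    simp only [LinearMap.mk₂_apply, Submodule.coe_add, Submodule.coe_smul, mul_add, add_mul,
      sgn_add, mul_comm q p]
    rcases sgn_eq k (p * q) with h | h <;> rcases sgn_eq k (p * r) with h' | h' <;>
      rcases sgn_eq k (q * r) with h'' | h'' <;> simp only [h, h', h'', one_smul, neg_smul,
      mul_one, mul_neg, neg_neg] <;> noncomm_ring

variable (k) in
/-- The `i`-th generator. -/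
noncomputable def lieGen (i : I) : (freeLie k deg).V (deg i) :=
  ⟨PowerSeries.monomial 1 (FreeAlgebra.ι k i), fun n => by
    rw [PowerSeries.coeff_monomial]
    split_ifs with h
    · subst h; exact Submodule.subset_span ⟨.of i, rfl, rfl, rfl⟩
    · exact zero_mem _⟩

/-- The algebra map `x_i ↦ !![(-1)^|x_i| x_i, D_i; 0, x_i]`. Its upper right entry is the signed
derivation with values in power series that sends `x_i` to `D_i`. -/
noncomputable def derMatrix (D : I → PowerSeries (FreeAlgebra k I)) :
    FreeAlgebra k I →ₐ[k] Matrix (Fin 2) (Fin 2) (PowerSeries (FreeAlgebra k I)) :=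
  FreeAlgebra.lift k fun i =>
    !![sgn k (deg i) • PowerSeries.monomial 1 (FreeAlgebra.ι k i), D i;
       0, PowerSeries.monomial 1 (FreeAlgebra.ι k i)]

/-- The signed derivation `x_i ↦ D_i` on noncommutative polynomials. -/
noncomputable def derPoly (D : I → PowerSeries (FreeAlgebra k I)) :
    FreeAlgebra k I →ₗ[k] PowerSeries (FreeAlgebra k I) where
  toFun a := derMatrix deg D a 0 1
  map_add' a b := by rw [map_add]; rfl
  map_smul' c a := by rw [map_smul]; rfl

/-- The signed derivation `x_i ↦ D_i` on noncommutative power series, applied to the components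
of each word length. It does not decrease word length when the `D_i` have no constant term, so
only the components of length at most `m` contribute to length `m`. -/
noncomputable def derSeries (D : I → PowerSeries (FreeAlgebra k I))
    (F : PowerSeries (FreeAlgebra k I)) : PowerSeries (FreeAlgebra k I) :=
  PowerSeries.mk fun m => ∑ n ∈ Finset.range (m + 1),
    PowerSeries.coeff m (derPoly deg D (PowerSeries.coeff n F))

theorem coeff_mon_ne {m n : ℕ} (h : m ≠ n) (a : FreeAlgebra k I) :
    PowerSeries.coeff m (PowerSeries.monomial n a) = 0 := by
  rw [PowerSeries.coeff_monomial, if_neg h]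

theorem smul_monomial (c : k) (n : ℕ) (a : FreeAlgebra k I) :
    c • PowerSeries.monomial n a = PowerSeries.monomial n (c • a) := by
  ext1 m
  rw [coeff_smul', PowerSeries.coeff_monomial, PowerSeries.coeff_monomial]
  split_ifs <;> simp

theorem derMatrix_of_mem (D : I → PowerSeries (FreeAlgebra k I)) {n : ℕ} {p : ℤ}
    {a : FreeAlgebra k I} (ha : a ∈ liePoly k deg n p) :
    derMatrix deg D a = !![sgn k p • PowerSeries.monomial n a, derPoly deg D a;
      0, PowerSeries.monomial n a] := by
  have tree : ∀ t : FreeMagma I, derMatrix deg D (treeLie k deg t) =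
      !![sgn k (treeDeg deg t) • PowerSeries.monomial t.length (treeLie k deg t),
        derPoly deg D (treeLie k deg t); 0,
        PowerSeries.monomial t.length (treeLie k deg t)] := by
    intro t
    induction t with
    | ih1 i =>
      have : derMatrix deg D (treeLie k deg (.of i)) =
        !![sgn k (deg i) • PowerSeries.monomial 1 (FreeAlgebra.ι k i), D i;
          0, PowerSeries.monomial 1 (FreeAlgebra.ι k i)] := by
        simp [derMatrix]
      have h2 : derPoly deg D (treeLie k deg (.of i)) = D i := by
        change derMatrix deg D (treeLie k deg (.of i)) 0 1 = D i
        rw [this]; rfl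
      rw [h2, this]; rfl
    | ih2 s t hs ht =>
      have key : derMatrix deg D (treeLie k deg (s * t)) =
          derMatrix deg D (treeLie k deg s) * derMatrix deg D (treeLie k deg t) -
          sgn k (treeDeg deg s * treeDeg deg t) •
          (derMatrix deg D (treeLie k deg t) * derMatrix deg D (treeLie k deg s)) := by
        simp
      have hl : (s * t).length = s.length + t.length := rfl
      have hm : PowerSeries.monomial (s * t).length (treeLie k deg (s * t)) =
          PowerSeries.monomial s.length (treeLie k deg s) *
            PowerSeries.monomial t.length (treeLie k deg t) -
          sgn k (treeDeg deg s * treeDeg deg t) •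
            (PowerSeries.monomial t.length (treeLie k deg t) *
            PowerSeries.monomial s.length (treeLie k deg s)) := by
        rw [PowerSeries.monomial_mul_monomial, PowerSeries.monomial_mul_monomial, smul_monomial,
          treeLie_mul, map_sub, hl, add_comm t.length]
      ext i j : 1
      fin_cases i <;> fin_cases j
      · simp only [key, hs, ht, hm]
        simp [sgn_add, smul_sub, smul_smul, mul_comm]
      · rfl
      · simp [hs, ht]
      · simp only [key, hs, ht, hm]
        simp
  induction ha using Submodule.span_induction with
  | zero => ext i j : 1; fin_cases i <;> fin_cases j <;> simp
  | mem x hx => obtain ⟨t, rfl, rfl, rfl⟩ := hx; exact tree t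
  | add x y _ _ hx hy =>
    rw [map_add, hx, hy]; ext i j : 1; fin_cases i <;> fin_cases j <;> simp
  | smul c x _ hx =>
    rw [map_smul, hx]
    ext i j : 1
    fin_cases i <;> fin_cases j <;> simp [smul_comm c]

theorem derPoly_mul (D : I → PowerSeries (FreeAlgebra k I)) {n m : ℕ} {p q : ℤ}
    {a b : FreeAlgebra k I} (ha : a ∈ liePoly k deg n p) (hb : b ∈ liePoly k deg m q) :
    derPoly deg D (a * b) = derPoly deg D a * PowerSeries.monomial m b +
      sgn k p • (PowerSeries.monomial n a * derPoly deg D b) := by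
  change derMatrix deg D (a * b) 0 1 = _
  rw [map_mul, derMatrix_of_mem deg D ha, derMatrix_of_mem deg D hb]
  simp [Matrix.mul_apply, Fin.sum_univ_two, add_comm]

theorem derPoly_ι (D : I → PowerSeries (FreeAlgebra k I)) (i : I) :
    derPoly deg D (FreeAlgebra.ι k i) = D i := by
  change derMatrix deg D (FreeAlgebra.ι k i) 0 1 = _
  simp [derMatrix]

theorem derPoly_mem {D : I → PowerSeries (FreeAlgebra k I)}
    (hD : ∀ i, D i ∈ lieHat k deg (deg i + 1)) {n : ℕ} {p : ℤ}
    {a : FreeAlgebra k I} (ha : a ∈ liePoly k deg n p) :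
    derPoly deg D a ∈ lieHat k deg (p + 1) ∧
      ∀ m < n, PowerSeries.coeff m (derPoly deg D a) = 0 := by
  induction ha using Submodule.span_induction with
  | zero => simp
  | add x y _ _ hx hy =>
    rw [map_add]
    exact ⟨add_mem hx.1 hy.1, fun m hm => by rw [map_add, hx.2 m hm, hy.2 m hm, add_zero]⟩
  | smul c x _ hx =>
    rw [map_smul]
    exact ⟨Submodule.smul_mem _ c hx.1, fun m hm => by rw [coeff_smul', hx.2 m hm, smul_zero]⟩
  | mem x hx =>
    obtain ⟨t, rfl, rfl, rfl⟩ := hx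
    induction t with
    | ih1 i =>
      rw [treeLie_of, derPoly_ι]
      refine ⟨hD i, fun m hm => ?_⟩
      have h0 : m = 0 := by
        have : (FreeMagma.of i).length = 1 := rfl
        omega
      have := hD i m
      rw [h0, liePoly_zero] at this
      rw [h0]; exact this
    | ih2 s t hs ht =>
      have ms : treeLie k deg s ∈ liePoly k deg s.length (treeDeg deg s) :=
        Submodule.subset_span ⟨s, rfl, rfl, rfl⟩
      have mt : treeLie k deg t ∈ liePoly k deg t.length (treeDeg deg t) :=
        Submodule.subset_span ⟨t, rfl, rfl, rfl⟩
      have hms : ∀ u : FreeMagma I, PowerSeries.monomial u.length (treeLie k deg u) ∈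
          lieHat k deg (treeDeg deg u) := fun u n => by
        rw [PowerSeries.coeff_monomial]
        split_ifs with h
        · subst h; exact Submodule.subset_span ⟨u, rfl, rfl, rfl⟩
        · exact zero_mem _
      have hl : (s * t).length = s.length + t.length := rfl
      rw [treeLie_mul, map_sub, map_smul, derPoly_mul deg D ms mt, derPoly_mul deg D mt ms]
      set δs := derPoly deg D (treeLie k deg s)
      set δt := derPoly deg D (treeLie k deg t)
      constructor
      · have e1 := lieHat_bracket deg hs.1 (hms t)
        have e2 := Submodule.smul_mem _ (sgn k (treeDeg deg s)) (lieHat_bracket deg (hms s) ht.1)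
        have e3 : treeDeg deg s + 1 + treeDeg deg t = treeDeg deg (s * t) + 1 := by
          rw [treeDeg_mul]; ring
        have e4 : treeDeg deg s + (treeDeg deg t + 1) = treeDeg deg (s * t) + 1 := by
          rw [treeDeg_mul]; ring
        rw [e3] at e1
        rw [e4] at e2
        convert add_mem e1 e2 using 1
        simp only [add_mul, mul_add, sgn_add, one_mul, mul_one]
        rcases sgn_eq k (treeDeg deg s * treeDeg deg t) with h | h <;>
          rcases sgn_eq k (treeDeg deg s) with h' | h' <;>
          rcases sgn_eq k (treeDeg deg t) with h'' | h'' <;>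
          simp only [h, h', h'', one_smul, neg_smul, mul_one, mul_neg, neg_neg] <;> noncomm_ring
      · intro m hm
        have z1 : ∀ (u v : FreeMagma I) (G : PowerSeries (FreeAlgebra k I)),
            (∀ m < u.length, PowerSeries.coeff m G = 0) → m < u.length + v.length →
            PowerSeries.coeff m (G * PowerSeries.monomial v.length (treeLie k deg v)) = 0 := by
          intro u v G hG hm
          rw [PowerSeries.coeff_mul]
          refine Finset.sum_eq_zero fun ij hij => ?_
          have := Finset.HasAntidiagonal.mem_antidiagonal.1 hij
          rw [PowerSeries.coeff_monomial]
          split_ifs with h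
          · rw [hG _ (by omega), zero_mul]
          · rw [mul_zero]
        have z2 : ∀ (u v : FreeMagma I) (G : PowerSeries (FreeAlgebra k I)),
            (∀ m < u.length, PowerSeries.coeff m G = 0) → m < u.length + v.length →
            PowerSeries.coeff m (PowerSeries.monomial v.length (treeLie k deg v) * G) = 0 := by
          intro u v G hG hm
          rw [PowerSeries.coeff_mul]
          refine Finset.sum_eq_zero fun ij hij => ?_
          have := Finset.HasAntidiagonal.mem_antidiagonal.1 hij
          rw [PowerSeries.coeff_monomial]
          split_ifs with h
          · rw [hG _ (by omega), mul_zero]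
          · rw [zero_mul]
        rw [hl] at hm
        simp only [map_sub, map_add, coeff_smul']
        rw [z1 s t δs hs.2 hm, z2 t s δt ht.2 (by omega), z1 t s δt ht.2 (by omega),
          z2 s t δs hs.2 hm]
        simp

theorem derSeries_mem {D : I → PowerSeries (FreeAlgebra k I)}
    (hD : ∀ i, D i ∈ lieHat k deg (deg i + 1)) {p : ℤ}
    {F : PowerSeries (FreeAlgebra k I)} (hF : F ∈ lieHat k deg p) :
    derSeries deg D F ∈ lieHat k deg (p + 1) := by
  intro m
  rw [derSeries, PowerSeries.coeff_mk]
  exact Submodule.sum_mem _ fun n _ => (derPoly_mem deg hD (hF n)).1 m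

theorem derSeries_mul (D : I → PowerSeries (FreeAlgebra k I)) {p q : ℤ}
    {F G : PowerSeries (FreeAlgebra k I)} (hF : F ∈ lieHat k deg p) (hG : G ∈ lieHat k deg q) :
    derSeries deg D (F * G) = derSeries deg D F * G + sgn k p • (F * derSeries deg D G) := by
  have sum_fst : ∀ (M : Type u) [AddCommMonoid M] (f : ℕ → ℕ → M) (m : ℕ),
      ∑ n ∈ Finset.range (m + 1), ∑ ab ∈ Finset.HasAntidiagonal.antidiagonal n, f ab.1 ab.2 =
      ∑ ib ∈ Finset.HasAntidiagonal.antidiagonal m,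
        ∑ a ∈ Finset.range (ib.1 + 1), f a ib.2 := by
    intro M _ f m
    rw [Finset.sum_sigma', Finset.sum_sigma']
    refine Finset.sum_bij' (fun x _ => ⟨(m - x.2.2, x.2.2), x.2.1⟩)
      (fun y _ => ⟨y.2 + y.1.2, (y.2, y.1.2)⟩) ?_ ?_ ?_ ?_ ?_
    · rintro ⟨n, a, b⟩ h; simp at h ⊢; omega
    · rintro ⟨⟨i, b⟩, a⟩ h; simp at h ⊢; omega
    · rintro ⟨n, a, b⟩ h; simp at h ⊢; omega
    · rintro ⟨⟨i, b⟩, a⟩ h; simp at h ⊢; omega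
    · rintro ⟨n, a, b⟩ h; rfl
  have coeff_mul_mon : ∀ (A : PowerSeries (FreeAlgebra k I)) (c : FreeAlgebra k I) (m b i : ℕ),
      i + b = m → PowerSeries.coeff m (A * PowerSeries.monomial b c) =
        PowerSeries.coeff i A * c := by
    rintro A c m b i rfl
    rw [PowerSeries.coeff_mul, Finset.sum_eq_single (i, b)]
    · rw [PowerSeries.coeff_monomial_same]
    · rintro ⟨x, y⟩ h hne
      have := Finset.HasAntidiagonal.mem_antidiagonal.1 h
      rw [coeff_mon_ne, mul_zero]
      rintro rfl
      exact hne (Prod.ext (by simp at this ⊢; omega) rfl)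
    · intro h; exact (h (Finset.HasAntidiagonal.mem_antidiagonal.2 rfl)).elim
  have coeff_mon_mul : ∀ (A : PowerSeries (FreeAlgebra k I)) (c : FreeAlgebra k I) (m a j : ℕ),
      a + j = m → PowerSeries.coeff m (PowerSeries.monomial a c * A) =
        c * PowerSeries.coeff j A := by
    rintro A c m a j rfl
    rw [PowerSeries.coeff_mul, Finset.sum_eq_single (a, j)]
    · rw [PowerSeries.coeff_monomial_same]
    · rintro ⟨x, y⟩ h hne
      have := Finset.HasAntidiagonal.mem_antidiagonal.1 h
      rw [coeff_mon_ne, zero_mul]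
      rintro rfl
      exact hne (Prod.ext rfl (by simp at this ⊢; omega))
    · intro h; exact (h (Finset.HasAntidiagonal.mem_antidiagonal.2 rfl)).elim
  ext1 m
  have h1 : PowerSeries.coeff m (derSeries deg D (F * G)) =
      ∑ n ∈ Finset.range (m + 1), ∑ ab ∈ Finset.HasAntidiagonal.antidiagonal n,
        PowerSeries.coeff m (derPoly deg D (PowerSeries.coeff ab.1 F) *
          PowerSeries.monomial ab.2 (PowerSeries.coeff ab.2 G)) +
      sgn k p • ∑ n ∈ Finset.range (m + 1), ∑ ab ∈ Finset.HasAntidiagonal.antidiagonal n,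
        PowerSeries.coeff m (PowerSeries.monomial ab.1 (PowerSeries.coeff ab.1 F) *
          derPoly deg D (PowerSeries.coeff ab.2 G)) := by
    rw [derSeries, PowerSeries.coeff_mk, Finset.smul_sum, ← Finset.sum_add_distrib]
    refine Finset.sum_congr rfl fun n _ => ?_
    rw [PowerSeries.coeff_mul, map_sum, map_sum, Finset.smul_sum, ← Finset.sum_add_distrib]
    refine Finset.sum_congr rfl fun ab _ => ?_
    rw [derPoly_mul deg D (hF ab.1) (hG ab.2), map_add, coeff_smul']
  rw [h1, map_add, coeff_smul', PowerSeries.coeff_mul, PowerSeries.coeff_mul]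
  congr 1
  · rw [sum_fst (FreeAlgebra k I) (fun a b => PowerSeries.coeff m
      (derPoly deg D (PowerSeries.coeff a F) *
        PowerSeries.monomial b (PowerSeries.coeff b G))) m]
    refine Finset.sum_congr rfl fun ib hib => ?_
    rw [derSeries, PowerSeries.coeff_mk, Finset.sum_mul]
    refine Finset.sum_congr rfl fun a _ => ?_
    exact coeff_mul_mon _ _ _ _ _ (Finset.HasAntidiagonal.mem_antidiagonal.1 hib)
  · congr 1
    have swap : ∀ n, ∑ ab ∈ Finset.HasAntidiagonal.antidiagonal n, PowerSeries.coeff m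
        (PowerSeries.monomial ab.1 (PowerSeries.coeff ab.1 F) *
          derPoly deg D (PowerSeries.coeff ab.2 G)) =
        ∑ ba ∈ Finset.HasAntidiagonal.antidiagonal n, PowerSeries.coeff m
        (PowerSeries.monomial ba.2 (PowerSeries.coeff ba.2 F) *
          derPoly deg D (PowerSeries.coeff ba.1 G)) := fun n => by
      rw [← Finset.Nat.sum_antidiagonal_swap]; rfl
    rw [Finset.sum_congr rfl fun n _ => swap n,
      sum_fst (FreeAlgebra k I) (fun b a => PowerSeries.coeff m
        (PowerSeries.monomial a (PowerSeries.coeff a F) *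
          derPoly deg D (PowerSeries.coeff b G))) m, ← Finset.Nat.sum_antidiagonal_swap]
    refine Finset.sum_congr rfl fun aj haj => ?_
    rw [derSeries, PowerSeries.coeff_mk, Finset.mul_sum]
    refine Finset.sum_congr rfl fun b _ => ?_
    exact coeff_mon_mul _ _ _ _ _ (Finset.HasAntidiagonal.mem_antidiagonal.1 haj)

theorem derSeries_add (D : I → PowerSeries (FreeAlgebra k I))
    (F G : PowerSeries (FreeAlgebra k I)) :
    derSeries deg D (F + G) = derSeries deg D F + derSeries deg D G := by
  ext1 m
  simp [derSeries, Finset.sum_add_distrib]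

theorem derSeries_smul (D : I → PowerSeries (FreeAlgebra k I)) (c : k)
    (F : PowerSeries (FreeAlgebra k I)) :
    derSeries deg D (c • F) = c • derSeries deg D F := by
  ext1 m
  simp only [derSeries, PowerSeries.coeff_mk, coeff_smul', map_smul, Finset.smul_sum]

/-- The free complete graded Lie algebra with the derivation of degree `1` that sends the `i`-th
generator to `D i`. -/
noncomputable def freeDerLie (D : ∀ i, (freeLie k deg).V (deg i + 1)) : DerLie k where
  toGradedLie := freeLie k deg
  d {p q} h :=
    { toFun := fun F => ⟨derSeries deg (fun i => (D i).1) F.1,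
        h ▸ derSeries_mem deg (fun i => (D i).2) F.2⟩
      map_add' := fun F G => Subtype.ext (derSeries_add deg _ F.1 G.1)
      map_smul' := fun c F => Subtype.ext (derSeries_smul deg _ c F.1) }
  leibniz {p q r p' q' t} h hr hp h₁ hq h₂ F G := by
    subst h hp hq
    refine Subtype.ext ?_
    change derSeries deg _ (F.1 * G.1 - sgn k (p * q) • (G.1 * F.1)) =
      (derSeries deg _ F.1 * G.1 - sgn k ((p + 1) * q) • (G.1 * derSeries deg _ F.1)) +
      sgn k p • (F.1 * derSeries deg _ G.1 - sgn k (p * (q + 1)) • (derSeries deg _ G.1 * F.1))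
    rw [sub_eq_add_neg, ← neg_smul, derSeries_add, derSeries_smul,
      derSeries_mul deg _ F.2 G.2, derSeries_mul deg _ G.2 F.2]
    simp only [add_mul, mul_add, sgn_add, one_mul, mul_one]
    rcases sgn_eq k (p * q) with h | h <;> rcases sgn_eq k p with h' | h' <;>
      rcases sgn_eq k q with h'' | h'' <;>
      simp only [h, h', h'', one_smul, neg_smul, mul_one, mul_neg, neg_neg] <;> noncomm_ring

/-- The derivation of `freeDerLie deg D` takes the prescribed values on the generators. -/
theorem freeDerLie_d_gen (D : ∀ i, (freeLie k deg).V (deg i + 1)) (i : I) :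
    (freeDerLie deg D).d rfl (lieGen k deg i) = D i := by
  refine Subtype.ext ?_
  change derSeries deg (fun i => (D i).1) (PowerSeries.monomial 1 (FreeAlgebra.ι k i)) = (D i).1
  ext1 m
  rw [derSeries, PowerSeries.coeff_mk]
  rcases Nat.eq_zero_or_pos m with rfl | hm
  · have := (D i).2 0
    rw [liePoly_zero] at this
    rw [this]
    simp [PowerSeries.coeff_monomial]
  · rw [Finset.sum_eq_single 1]
    · rw [PowerSeries.coeff_monomial_same, derPoly_ι]
    · intro n _ hn
      rw [coeff_mon_ne hn]; simp
    · intro h; simp at h; omega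

end Free

/-! ## Contractions of commutative dg algebras and the complete cobar construction -/

/-- Commutative dg algebras (graded-commutative, cohomologically `ℤ`-graded) over `k`. -/
structure CDGA (k : Type u) [Field k] where
  /-- the underlying algebra -/
  A : Type u
  [ring : Ring A]
  [algebra : Algebra k A]
  /-- the homogeneous components -/
  gr : ℤ → Submodule k A
  internal : DirectSum.IsInternal gr
  one_mem : (1 : A) ∈ gr 0
  mul_mem : ∀ {p q : ℤ} {a b : A}, a ∈ gr p → b ∈ gr q → a * b ∈ gr (p + q)
  comm : ∀ {p q : ℤ} {a b : A}, a ∈ gr p → b ∈ gr q → a * b = sgn k (p * q) • (b * a)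
  /-- the differential -/
  d : A →ₗ[k] A
  d_mem : ∀ {p : ℤ} {a : A}, a ∈ gr p → d a ∈ gr (p + 1)
  d_d : ∀ a, d (d a) = 0
  leibniz : ∀ {p : ℤ} {a b : A}, a ∈ gr p → d (a * b) = d a * b + sgn k p • (a * d b)

attribute [instance] CDGA.ring CDGA.algebra

/-- A contraction of the commutative dg algebra `Ω` onto a finite dimensional subcomplex `C` with
homogeneous basis `e i`, `i : I`, of degrees `deg i`. The inclusion of `C` is determined by the
elements `e i` of `Ω`, and the projection `Ω → C` is `a ↦ ∑ i, p i a • e i`. The differential of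
`C` has the matrix `p i (d (e j))`. -/
structure Contraction {k : Type u} [Field k] (Ω : CDGA k) (I : Type) [Fintype I]
    [DecidableEq I] where
  /-- the degrees of the basis of `C` -/
  deg : I → ℤ
  /-- the basis of `C`, as elements of `Ω` -/
  e : I → Ω.A
  /-- the coordinates of the projection onto `C` -/
  p : I → Ω.A →ₗ[k] k
  /-- the homotopy -/
  h : Ω.A →ₗ[k] Ω.A
  e_mem : ∀ i, e i ∈ Ω.gr (deg i)
  p_of_ne : ∀ {q : ℤ} {a : Ω.A} (i : I), a ∈ Ω.gr q → q ≠ deg i → p i a = 0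
  h_mem : ∀ {q : ℤ} {a : Ω.A}, a ∈ Ω.gr q → h a ∈ Ω.gr (q - 1)
  d_e : ∀ j, Ω.d (e j) = ∑ i, p i (Ω.d (e j)) • e i
  p_d : ∀ i a, p i (Ω.d a) = ∑ j, p j a * p i (Ω.d (e j))
  p_e : ∀ i j, p i (e j) = if i = j then 1 else 0
  homotopy : ∀ a, a - ∑ i, p i a • e i = Ω.d (h a) + h (Ω.d a)
  h_e : ∀ i, h (e i) = 0
  p_h : ∀ i a, p i (h a) = 0
  h_h : ∀ a, h (h a) = 0

/-- The binary planar trees with `n` leaves, with leaves labelled by `I`. -/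
def trees (I : Type) [Fintype I] [DecidableEq I] : ℕ → Finset (FreeMagma I)
  | 0 => ∅
  | 1 => Finset.univ.image FreeMagma.of
  | n + 2 => (Finset.HasAntidiagonal.antidiagonal n).attach.biUnion fun ab =>
      have h := Finset.HasAntidiagonal.mem_antidiagonal.1 ab.2
      have : ab.1.1 < n + 1 := by omega
      have : ab.1.2 < n + 1 := by omega
      (trees I (ab.1.1 + 1) ×ˢ trees I (ab.1.2 + 1)).image fun st => st.1 * st.2

theorem mem_trees {I : Type} [Fintype I] [DecidableEq I] {n : ℕ} {t : FreeMagma I} :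
    t ∈ trees I n ↔ t.length = n := by
  induction t generalizing n with
  | ih1 i =>
    have h1 : (FreeMagma.of i).length = 1 := rfl
    rw [h1]
    match n with
    | 0 => simp [trees]
    | 1 => simp [trees]
    | n + 2 =>
      rw [trees]
      simp only [Finset.mem_biUnion, Finset.mem_image]
      constructor
      · rintro ⟨_, _, _, _, h⟩; cases h
      · intro h; omega
  | ih2 s t hs ht =>
    have h1 : (s * t).length = s.length + t.length := rfl
    have ps := s.length_pos
    have pt := t.length_pos
    rw [h1]
    match n with
    | 0 => simp [trees]; omega
    | 1 =>
      rw [trees]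
      constructor
      · intro h
        obtain ⟨i, _, h⟩ := Finset.mem_image.1 h
        cases h
      · intro h; omega
    | n + 2 =>
      rw [trees]
      simp only [Finset.mem_biUnion, Finset.mem_image]
      constructor
      · rintro ⟨⟨ab, hab⟩, -, ⟨s', t'⟩, hst, h⟩
        have hab := Finset.HasAntidiagonal.mem_antidiagonal.1 hab
        cases h
        have h3 := Finset.mem_product.1 hst
        have e1 := hs.1 h3.1
        have e2 := ht.1 h3.2
        change s'.length = ab.1 + 1 at e1
        change t'.length = ab.2 + 1 at e2
        change s'.length + t'.length = n + 2
        omega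
      · intro h
        refine ⟨⟨(s.length - 1, t.length - 1),
          Finset.HasAntidiagonal.mem_antidiagonal.2 (by simp only; omega)⟩, Finset.mem_attach _ _,
          (s, t), Finset.mem_product.2 ⟨hs.2 ?_, ht.2 ?_⟩, rfl⟩
        · simp only; omega
        · simp only; omega

namespace Contraction

variable {k : Type u} [Field k] {Ω : CDGA k} {I : Type} [Fintype I] [DecidableEq I]

/-- The degree `1 - deg i` of the generator `s eᵢ^∨` of `s C^∨`. -/
def genDeg (c : Contraction Ω I) (i : I) : ℤ := 1 - c.deg i

/-- The part of the transferred structure given by a labelled binary tree, before projecting to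
`C`: the basis elements of `C`, included in `Ω`, at the leaves, the product of `Ω` at the
vertices, and the homotopy after every vertex, with a factor `½` for each vertex because planar
trees are counted. The signs are those of the iteration `ψ = κ - ½ h [ψ, ψ]` in the tensor
product of a graded Lie algebra with `Ω`, where `κ = ∑ i, xᵢ ⊗ eᵢ` has degree `1`,
`[x ⊗ a, y ⊗ b] = (-1)^(|a| |y|) [x, y] ⊗ a b` and `h (x ⊗ a) = (-1)^|x| x ⊗ h a`. -/
def treeForm (c : Contraction Ω I) : FreeMagma I → Ω.A
  | .of i => c.e i
  | .mul s t =>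
      -((2 : k)⁻¹ * sgn k ((1 - treeDeg c.genDeg s) * treeDeg c.genDeg t +
        (treeDeg c.genDeg s + treeDeg c.genDeg t))) • c.h (treeForm c s * treeForm c t)

/-- The coefficient of the bracketing `t` in the cobar differential of the generator `s eᵢ^∨`.
A tree with one leaf contributes the dual of the differential of `C`, and a tree with at least
two leaves contributes the dual of the transferred operation (the projection at the root), so
that `dκ + d_C κ + p (½ [ψ, ψ]) = 0` for `ψ = κ - ½ h [ψ, ψ]`. -/
def treeCoeff (c : Contraction Ω I) (i : I) : FreeMagma I → k
  | .of j => -(sgn k (c.genDeg j) * c.p i (Ω.d (c.e j)))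
  | .mul s t =>
      -((2 : k)⁻¹ * sgn k ((1 - treeDeg c.genDeg s) * treeDeg c.genDeg t) *
        c.p i (c.treeForm s * c.treeForm t))

theorem treeForm_mem (c : Contraction Ω I) (t : FreeMagma I) :
    c.treeForm t ∈ Ω.gr (1 - treeDeg c.genDeg t) := by
  induction t with
  | ih1 i =>
    have : 1 - treeDeg c.genDeg (.of i) = c.deg i := by simp [genDeg]
    rw [this]; exact c.e_mem i
  | ih2 s t hs ht =>
    have : 1 - treeDeg c.genDeg (s * t) =
      (1 - treeDeg c.genDeg s) + (1 - treeDeg c.genDeg t) - 1 := by simp; ring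
    rw [this]
    exact Submodule.smul_mem _ _ (c.h_mem (Ω.mul_mem hs ht))

theorem treeCoeff_eq_zero (c : Contraction Ω I) (i : I) (t : FreeMagma I)
    (ht : treeDeg c.genDeg t ≠ c.genDeg i + 1) : c.treeCoeff i t = 0 := by
  induction t with
  | ih1 j =>
    have : c.p i (Ω.d (c.e j)) = 0 := by
      refine c.p_of_ne i (Ω.d_mem (c.e_mem j)) fun h => ht ?_
      simp only [treeDeg_of, genDeg]; omega
    change -(_ * c.p i (Ω.d (c.e j))) = 0
    rw [this, mul_zero, neg_zero]
  | ih2 s t _ _ =>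
    have : c.p i (c.treeForm s * c.treeForm t) = 0 := by
      refine c.p_of_ne i (Ω.mul_mem (c.treeForm_mem s) (c.treeForm_mem t)) fun h => ht ?_
      simp only [treeDeg_mul]
      simp only [genDeg] at h ⊢
      omega
    change -(_ * c.p i (c.treeForm s * c.treeForm t)) = 0
    rw [this, mul_zero, neg_zero]

/-- The cobar differential of the generator `s eᵢ^∨`: the sum over all labelled binary trees. -/
noncomputable def genD (c : Contraction Ω I) (i : I) :
    (freeLie k c.genDeg).V (c.genDeg i + 1) :=
  ⟨PowerSeries.mk fun n => ∑ t ∈ trees I n, c.treeCoeff i t • treeLie k c.genDeg t, fun n => by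
    rw [PowerSeries.coeff_mk]
    refine Submodule.sum_mem _ fun t ht => ?_
    by_cases h : treeDeg c.genDeg t = c.genDeg i + 1
    · exact Submodule.smul_mem _ _ (Submodule.subset_span ⟨t, mem_trees.1 ht, h, rfl⟩)
    · rw [c.treeCoeff_eq_zero i t h, zero_smul]; exact zero_mem _⟩

/-- The complete cobar construction of `s C^∨`, where `C` carries the homotopy commutative
algebra structure transferred from `Ω` along the contraction. -/
noncomputable def cobar (c : Contraction Ω I) : DerLie k := freeDerLie c.genDeg c.genD

/-- The generator `s eᵢ^∨`. -/
noncomputable def gen (c : Contraction Ω I) (i : I) : c.cobar.V (c.genDeg i) :=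
  lieGen k c.genDeg i

end Contraction

/-! ## Polynomial forms on the point and on the interval -/

section Forms

open Polynomial

variable (k : Type u) [Field k]

/-- The grading of `Ω₀ = k`, concentrated in degree `0`. -/
def gr0 (n : ℤ) : Submodule k k where
  carrier := {a | n ≠ 0 → a = 0}
  zero_mem' := fun _ => rfl
  add_mem' := fun ha hb hn => by rw [ha hn, hb hn, add_zero]
  smul_mem' := fun c a ha hn => by rw [ha hn, smul_zero]

theorem gr0_internal : DirectSum.IsInternal (gr0 k) := by
  classical
  refine @DirectSum.Decomposition.isInternal _ _ _ _ _ _ _ (gr0 k)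
    (DirectSum.Decomposition.ofLinearMap (gr0 k)
      ((DirectSum.lof k ℤ (fun n => gr0 k n) 0) ∘ₗ
        (LinearMap.id.codRestrict (gr0 k 0) fun a h => absurd rfl h)) ?_ ?_)
  · ext
    simp only [LinearMap.comp_apply, DirectSum.coeLinearMap_lof]
    rfl
  · ext n ⟨a, ha⟩ : 2
    by_cases hn : n = 0
    · subst hn
      simp only [LinearMap.comp_apply, DirectSum.coeLinearMap_lof, LinearMap.id_apply]
      rfl
    · obtain rfl : a = 0 := ha hn
      have : (⟨0, ha⟩ : gr0 k n) = 0 := rfl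
      rw [this, map_zero, map_zero]

/-- The polynomial forms `Ω₀ = k` on the point. -/
def omega0 : CDGA k where
  A := k
  gr := gr0 k
  internal := gr0_internal k
  one_mem h := absurd rfl h
  mul_mem := by
    intro p q a b ha hb h
    by_cases hp : p = 0
    · rw [hb (by omega), mul_zero]
    · rw [ha hp, zero_mul]
  comm := by
    intro p q a b ha hb
    by_cases hp : p = 0
    · subst hp; simp [mul_comm]
    · rw [ha hp]; simp
  d := 0
  d_mem _ := zero_mem _
  d_d _ := rfl
  leibniz _ := by simp

/-- The contraction of `Ω₀ = k` onto `C₀ = k`: inclusion and projection are the identity and the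
homotopy is zero. -/
def dupont0 : Contraction (omega0 k) Unit where
  deg _ := 0
  e _ := (1 : k)
  p _ := LinearMap.id (M := k)
  h := 0
  e_mem _ := (omega0 k).one_mem
  p_of_ne _ ha hq := ha hq
  h_mem _ := zero_mem _
  d_e _ := by
    change (0 : k) = ∑ _ : Unit, (0 : k) * 1
    simp
  p_d _ a := by
    change k at a
    change (0 : k) = ∑ _ : Unit, a * (0 : k)
    simp
  p_e _ _ := by
    change (1 : k) = _
    simp
  homotopy a := by
    change k at a
    change a - ∑ _ : Unit, a * 1 = (0 : k) + 0
    simp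
  h_e _ := rfl
  p_h _ _ := rfl
  h_h _ := rfl

/-- The dg Lie algebra `mc₀`. -/
noncomputable def mc0 : DerLie k := (dupont0 k).cobar

/-- The generator `α = s 1^∨` of `mc₀`, of degree `1`. -/
noncomputable def mc0Gen : (mc0 k).V 1 := (dupont0 k).gen ()

/-- The grading of `k[t] ⊕ k[t] dt`. -/
def gr1 (n : ℤ) : Submodule k (DualNumber k[X]) where
  carrier := {a | (n ≠ 0 → a.fst = 0) ∧ (n ≠ 1 → a.snd = 0)}
  zero_mem' := ⟨fun _ => rfl, fun _ => rfl⟩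
  add_mem' := fun ha hb => ⟨fun hn => by simp [ha.1 hn, hb.1 hn],
    fun hn => by simp [ha.2 hn, hb.2 hn]⟩
  smul_mem' := fun c a ha => ⟨fun hn => by simp [ha.1 hn], fun hn => by simp [ha.2 hn]⟩

/-- The coefficient `f` of the form `f + g dt`. -/
def fstL : DualNumber k[X] →ₗ[k] k[X] where
  toFun := TrivSqZeroExt.fst
  map_add' _ _ := rfl
  map_smul' _ _ := rfl

/-- The coefficient `g` of the form `f + g dt`. -/
def sndL : DualNumber k[X] →ₗ[k] k[X] where
  toFun := TrivSqZeroExt.snd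
  map_add' _ _ := rfl
  map_smul' _ _ := rfl

/-- The polynomial `f` as a `0`-form. -/
noncomputable def inlL : k[X] →ₗ[k] DualNumber k[X] where
  toFun := TrivSqZeroExt.inl
  map_add' _ _ := TrivSqZeroExt.inl_add _ _ _
  map_smul' _ _ := TrivSqZeroExt.inl_smul _ _ _

/-- The `1`-form `g dt`. -/
noncomputable def inrL : k[X] →ₗ[k] DualNumber k[X] where
  toFun := TrivSqZeroExt.inr
  map_add' _ _ := TrivSqZeroExt.inr_add _ _ _
  map_smul' _ _ := TrivSqZeroExt.inr_smul _ _ _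

@[simp] theorem fst_inlL (f : k[X]) : (inlL k f).fst = f := rfl
@[simp] theorem snd_inlL (f : k[X]) : (inlL k f).snd = 0 := rfl
@[simp] theorem fst_inrL (f : k[X]) : (inrL k f).fst = 0 := rfl
@[simp] theorem snd_inrL (f : k[X]) : (inrL k f).snd = f := rfl
@[simp] theorem fstL_apply (a : DualNumber k[X]) : fstL k a = a.fst := rfl
@[simp] theorem sndL_apply (a : DualNumber k[X]) : sndL k a = a.snd := rfl

theorem inlL_mem (f : k[X]) : inlL k f ∈ gr1 k 0 := ⟨fun h => absurd rfl h, fun _ => rfl⟩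

theorem inrL_mem (f : k[X]) : inrL k f ∈ gr1 k 1 := ⟨fun _ => rfl, fun h => absurd rfl h⟩

theorem gr1_internal : DirectSum.IsInternal (gr1 k) := by
  classical
  refine @DirectSum.Decomposition.isInternal _ _ _ _ _ _ _ (gr1 k)
    (DirectSum.Decomposition.ofLinearMap (gr1 k)
      ((DirectSum.lof k ℤ (fun n => gr1 k n) 0) ∘ₗ
        ((inlL k ∘ₗ fstL k).codRestrict (gr1 k 0) fun a => inlL_mem k _) +
       (DirectSum.lof k ℤ (fun n => gr1 k n) 1) ∘ₗ
        ((inrL k ∘ₗ sndL k).codRestrict (gr1 k 1) fun a => inrL_mem k _)) ?_ ?_)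
  · refine LinearMap.ext fun a => ?_
    simp only [LinearMap.comp_apply, LinearMap.add_apply, map_add, DirectSum.coeLinearMap_lof]
    change inlL k a.fst + inrL k a.snd = a
    ext <;> simp
  · ext n ⟨a, ha⟩ : 2
    simp only [LinearMap.comp_apply, LinearMap.add_apply, DirectSum.coeLinearMap_lof,
      LinearMap.id_apply]
    by_cases h0 : n = 0
    · subst h0
      have e1 : (inlL k ∘ₗ fstL k).codRestrict (gr1 k 0) (fun a => inlL_mem k _) a = ⟨a, ha⟩ :=
        Subtype.ext (TrivSqZeroExt.ext rfl (ha.2 (by norm_num)).symm)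
      have e2 : (inrL k ∘ₗ sndL k).codRestrict (gr1 k 1) (fun a => inrL_mem k _) a = 0 :=
        Subtype.ext (TrivSqZeroExt.ext rfl (ha.2 (by norm_num)))
      rw [e1, e2, map_zero, add_zero]
    · have e1 : (inlL k ∘ₗ fstL k).codRestrict (gr1 k 0) (fun a => inlL_mem k _) a = 0 :=
        Subtype.ext (TrivSqZeroExt.ext (ha.1 h0) rfl)
      by_cases h1 : n = 1
      · subst h1
        have e2 : (inrL k ∘ₗ sndL k).codRestrict (gr1 k 1) (fun a => inrL_mem k _) a = ⟨a, ha⟩ :=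
          Subtype.ext (TrivSqZeroExt.ext (ha.1 h0).symm rfl)
        rw [e1, e2, map_zero, zero_add]
      · have e2 : (inrL k ∘ₗ sndL k).codRestrict (gr1 k 1) (fun a => inrL_mem k _) a = 0 :=
          Subtype.ext (TrivSqZeroExt.ext rfl (ha.2 h1))
        have e3 : (⟨a, ha⟩ : gr1 k n) = 0 := Subtype.ext (TrivSqZeroExt.ext (ha.1 h0) (ha.2 h1))
        rw [e1, e2, e3]
        simp only [map_zero, add_zero]

/-- The polynomial forms on the interval: with `t = t₁`, `t₀ = 1 - t` and `dt = dt₁ = -dt₀`, the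
algebra `Ω₁ = k[t₀, t₁, dt₀, dt₁] / (t₀ + t₁ - 1, dt₀ + dt₁)` is `k[t] ⊕ k[t] dt` with
`dt * dt = 0`. The form `f + g dt` is the dual number with components `f` and `g`. -/
noncomputable def omega1 : CDGA k where
  A := DualNumber k[X]
  gr := gr1 k
  internal := gr1_internal k
  one_mem := ⟨fun h => absurd rfl h, fun _ => rfl⟩
  mul_mem := by
    intro p q a b ha hb
    refine ⟨fun h => ?_, fun h => ?_⟩
    · rw [TrivSqZeroExt.fst_mul]
      by_cases hp : p = 0
      · rw [hb.1 (by omega), mul_zero]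
      · rw [ha.1 hp, zero_mul]
    · rw [DualNumber.snd_mul]
      have h1 : a.fst * b.snd = 0 := by
        by_cases hp : p = 0
        · rw [hb.2 (by omega), mul_zero]
        · rw [ha.1 hp, zero_mul]
      have h2 : a.snd * b.fst = 0 := by
        by_cases hp : p = 1
        · rw [hb.1 (by omega), mul_zero]
        · rw [ha.2 hp, zero_mul]
      rw [h1, h2, add_zero]
  comm := by
    intro p q a b ha hb
    by_cases hp : p = 0
    · subst hp; simp [mul_comm]
    by_cases hq : q = 0
    · subst hq; simp [mul_comm]
    have h1 : a * b = 0 := by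
      ext <;> simp [ha.1 hp, hb.1 hq]
    rw [mul_comm b, h1, smul_zero]
  d := inrL k ∘ₗ derivative ∘ₗ fstL k
  d_mem := by
    intro p a ha
    refine ⟨fun _ => rfl, fun h => ?_⟩
    change derivative a.fst = 0
    rw [ha.1 (by omega), derivative_zero]
  d_d a := by simp
  leibniz := by
    intro p a b ha
    by_cases hp : p = 0
    · subst hp
      ext <;> simp [mul_comm, add_comm]
    · ext <;> simp [ha.1 hp]

/-- The formal integral `∫₀ᵗ g dt` of a polynomial. -/
noncomputable def antideriv : k[X] →ₗ[k] k[X] :=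
  Polynomial.lsum fun n => ((n + 1 : ℕ) : k)⁻¹ • Polynomial.monomial (n + 1)

theorem antideriv_monomial (n : ℕ) (c : k) :
    antideriv k (monomial n c) = monomial (n + 1) (((n + 1 : ℕ) : k)⁻¹ * c) := by
  rw [antideriv, Polynomial.lsum_apply, Polynomial.sum_monomial_index]
  · rw [LinearMap.smul_apply, Polynomial.smul_monomial, smul_eq_mul]
  · simp

theorem derivative_antideriv [CharZero k] (g : k[X]) : derivative (antideriv k g) = g := by
  induction g using Polynomial.induction_on' with
  | add p q hp hq => rw [map_add, map_add, hp, hq]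
  | monomial n c =>
    rw [antideriv_monomial, derivative_monomial]
    have : ((n + 1 : ℕ) : k) ≠ 0 := by exact_mod_cast Nat.succ_ne_zero n
    congr 1
    field_simp

theorem antideriv_derivative [CharZero k] (f : k[X]) :
    antideriv k (derivative f) = f - C (f.eval 0) := by
  induction f using Polynomial.induction_on' with
  | add p q hp hq => rw [map_add, map_add, hp, hq, eval_add, C_add]; ring
  | monomial n c =>
    rw [derivative_monomial, antideriv_monomial]
    rcases n with _ | n
    · simp
    · have : ((n + 1 : ℕ) : k) ≠ 0 := by exact_mod_cast Nat.succ_ne_zero n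
      rw [Nat.add_sub_cancel]
      have h2 : ((n + 1 : ℕ) : k)⁻¹ * (c * ((n + 1 : ℕ) : k)) = c := by field_simp
      rw [h2]; simp

theorem antideriv_eval_zero (g : k[X]) : (antideriv k g).eval 0 = 0 := by
  induction g using Polynomial.induction_on' with
  | add p q hp hq => rw [map_add, eval_add, hp, hq, add_zero]
  | monomial n c => rw [antideriv_monomial]; simp

/-- The nonempty faces of the interval: the two vertices and the edge. -/
inductive Face1
  | v0 | v1 | e01
  deriving DecidableEq

instance : Fintype Face1 := ⟨{.v0, .v1, .e01}, by rintro ⟨⟩ <;> simp⟩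

theorem Face1.sum_eq {M : Type u} [AddCommMonoid M] (f : Face1 → M) :
    ∑ i, f i = f .v0 + f .v1 + f .e01 := by
  change ∑ i ∈ {Face1.v0, Face1.v1, Face1.e01}, f i = _
  rw [Finset.sum_insert (by simp), Finset.sum_insert (by simp), Finset.sum_singleton, add_assoc]

/-- The dimension of a face. -/
def Face1.dim : Face1 → ℤ
  | .v0 => 0
  | .v1 => 0
  | .e01 => 1

/-- The basic forms `ω₀ = t₀ = 1 - t`, `ω₁ = t₁ = t` and `ω₀₁ = t₀ dt₁ - t₁ dt₀ = dt`. -/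
noncomputable def basicForm : Face1 → DualNumber k[X]
  | .v0 => inlL k (1 - X)
  | .v1 => inlL k X
  | .e01 => inrL k 1

/-- Integration of a form over the faces: the values at the vertices `t = 0` and `t = 1`, and
`∫₀¹ g dt`. -/
noncomputable def faceIntegral : Face1 → DualNumber k[X] →ₗ[k] k
  | .v0 => leval 0 ∘ₗ fstL k
  | .v1 => leval 1 ∘ₗ fstL k
  | .e01 => leval 1 ∘ₗ antideriv k ∘ₗ sndL k

/-- Dupont's homotopy on the interval: `f + g dt ↦ ∫₀ᵗ g - t ∫₀¹ g`. -/
noncomputable def dupontHomotopy : DualNumber k[X] →ₗ[k] DualNumber k[X] :=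
  inlL k ∘ₗ (antideriv k ∘ₗ sndL k -
    (LinearMap.toSpanSingleton k k[X] X) ∘ₗ faceIntegral k .e01)

theorem antideriv_one [CharZero k] : antideriv k 1 = X := by
  simpa using antideriv_derivative k X

theorem faceIntegral_v0 (a : DualNumber k[X]) : faceIntegral k .v0 a = eval 0 a.fst := rfl
theorem faceIntegral_v1 (a : DualNumber k[X]) : faceIntegral k .v1 a = eval 1 a.fst := rfl
theorem faceIntegral_e01 (a : DualNumber k[X]) :
    faceIntegral k .e01 a = eval 1 (antideriv k a.snd) := rfl
theorem dupontHomotopy_apply (a : DualNumber k[X]) : dupontHomotopy k a =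
    inlL k (antideriv k a.snd - eval 1 (antideriv k a.snd) • X) := rfl

theorem basicForm_d [CharZero k] (j : Face1) : inrL k (derivative (basicForm k j).fst) =
    ∑ i, faceIntegral k i (inrL k (derivative (basicForm k j).fst)) • basicForm k i := by
  rw [Face1.sum_eq]
  simp only [faceIntegral_v0, faceIntegral_v1, faceIntegral_e01, snd_inrL, fst_inrL,
    antideriv_derivative]
  apply TrivSqZeroExt.ext <;> cases j <;> simp [basicForm]

theorem faceIntegral_d [CharZero k] (i : Face1) (a : DualNumber k[X]) :
    faceIntegral k i (inrL k (derivative a.fst)) =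
      ∑ j, faceIntegral k j a * faceIntegral k i (inrL k (derivative (basicForm k j).fst)) := by
  rw [Face1.sum_eq]
  cases i <;> simp only [faceIntegral_v0, faceIntegral_v1, faceIntegral_e01, snd_inrL, fst_inrL,
    antideriv_derivative] <;> simp [basicForm]
  ring

theorem faceIntegral_basicForm [CharZero k] (i j : Face1) :
    faceIntegral k i (basicForm k j) = if i = j then 1 else 0 := by
  cases i <;> cases j <;> simp [faceIntegral_v0, faceIntegral_v1, faceIntegral_e01, basicForm,
    antideriv_one]

theorem dupont_homotopy [CharZero k] (a : DualNumber k[X]) :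
    a - ∑ i, faceIntegral k i a • basicForm k i =
      inrL k (derivative (dupontHomotopy k a).fst) +
        dupontHomotopy k (inrL k (derivative a.fst)) := by
  rw [Face1.sum_eq]
  simp only [faceIntegral_v0, faceIntegral_v1, faceIntegral_e01, dupontHomotopy_apply, snd_inrL,
    fst_inlL, antideriv_derivative, basicForm]
  apply TrivSqZeroExt.ext
  · simp only [TrivSqZeroExt.fst_sub, TrivSqZeroExt.fst_add, TrivSqZeroExt.fst_smul, fst_inlL,
      fst_inrL, eval_sub, eval_C, smul_eq_C_mul, C_sub]
    ring
  · simp only [TrivSqZeroExt.snd_sub, TrivSqZeroExt.snd_add, TrivSqZeroExt.snd_smul, snd_inlL,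
      snd_inrL, derivative_sub, derivative_antideriv, derivative_smul, derivative_X]
    simp

theorem dupontHomotopy_basicForm [CharZero k] (i : Face1) :
    dupontHomotopy k (basicForm k i) = 0 := by
  cases i <;> simp [dupontHomotopy_apply, basicForm, antideriv_one]

theorem faceIntegral_dupontHomotopy (i : Face1) (a : DualNumber k[X]) :
    faceIntegral k i (dupontHomotopy k a) = 0 := by
  cases i <;> simp [dupontHomotopy_apply, faceIntegral_v0, faceIntegral_v1, faceIntegral_e01,
    antideriv_eval_zero]

theorem dupontHomotopy_sq (a : DualNumber k[X]) :
    dupontHomotopy k (dupontHomotopy k a) = 0 := by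
  simp [dupontHomotopy_apply]

/-- Dupont's contraction of `Ω₁` onto the span `C₁` of the basic forms. (Its homotopy is the only
one that satisfies the identities of a contraction for these projections.) -/
noncomputable def dupont1 [CharZero k] : Contraction (omega1 k) Face1 where
  deg := Face1.dim
  e := basicForm k
  p := faceIntegral k
  h := dupontHomotopy k
  e_mem := by
    rintro ⟨⟩
    · exact inlL_mem k _
    · exact inlL_mem k _
    · exact inrL_mem k _
  p_of_ne := by
    rintro q a ⟨⟩ ha hq
    · change eval 0 a.fst = 0
      rw [ha.1 hq, eval_zero]
    · change eval 1 a.fst = 0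
      rw [ha.1 hq, eval_zero]
    · change eval 1 (antideriv k a.snd) = 0
      rw [ha.2 hq, map_zero, eval_zero]
  h_mem := by
    intro q a ha
    refine ⟨fun h => ?_, fun _ => rfl⟩
    change antideriv k a.snd - (eval 1 (antideriv k a.snd)) • X = 0
    rw [ha.2 (by omega), map_zero, eval_zero, zero_smul, sub_zero]
  d_e := basicForm_d k
  p_d := faceIntegral_d k
  p_e := faceIntegral_basicForm k
  homotopy := dupont_homotopy k
  h_e := dupontHomotopy_basicForm k
  p_h := faceIntegral_dupontHomotopy k
  h_h := dupontHomotopy_sq k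

/-- The dg Lie algebra `mc₁`. -/
noncomputable def mc1 [CharZero k] : DerLie k := (dupont1 k).cobar

/-- The generator `α₀ = s ω₀^∨` of `mc₁`, of degree `1`. -/
noncomputable def mc1Gen0 [CharZero k] : (mc1 k).V 1 := (dupont1 k).gen .v0

/-- The generator `α₁ = s ω₁^∨` of `mc₁`, of degree `1`. -/
noncomputable def mc1Gen1 [CharZero k] : (mc1 k).V 1 := (dupont1 k).gen .v1

/-- The generator `λ = s ω₀₁^∨` of `mc₁`, of degree `0`. -/
noncomputable def mc1Gen01 [CharZero k] : (mc1 k).V 0 := (dupont1 k).gen .e01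

end Forms

end LieMC

/-! The universal property of `freeLie` needs two facts. Word length and the canonical filtration
agree when there are finitely many generators (`coeff_eq_zero_of_mem_F`, `mem_F_of_coeff_eq_zero`);
this gives completeness and density of the Lie polynomials, so that linear identities can be checked
on generators. Evaluation of Lie polynomials is well defined by the Dynkin–Specht–Wever formula
(`dynkinRep_treeLie`), which uses characteristic 0.

At a vertex, the projection is a multiplicative evaluation that kills the image of the homotopy, so
in the differential of a vertex generator only the two-leaf tree survives, and this is the
Maurer–Cartan equation (`genD_eq_of_mul`).

On the interval, the homotopy takes values in 0-forms, hence ψ = A(t) ± λ dt with A a series of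
polynomial 0-forms, and every contributing tree with at least two leaves has the leaf λ at its root.
Counting both planar orders gives A = (1 - t) α₀ + t α₁ - [λ, hA], where hA is the homotopy applied
to A dt, and dλ = α₁ - α₀ + [λ, ∫₀¹ A]. Since (hA)' = A - ∫₀¹ A, this yields A' = dλ - [λ, A]; since
hA vanishes at both ends, A(0) = α₀ and A(1) = α₁. Thus the coefficients of A in powers of t are the
gauge flow (`flow_formSeries`, `mc1_isGauge`).

The differential of a gauge is forced by its endpoints: a solution of r' = u - [x, r] with r(0) =
r(1) = 0 exists only for u = 0 (`eq_zero_of_flow`). With r the curvature of the flow and u = d²x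
this gives d²x = 0 (`IsGauge.d_d_eq_zero`). With r the difference of two flows it shows that a
morphism respecting the generators commutes with d on the gauge (`IsGauge.map_d`). On Maurer–Cartan
generators both statements are direct. Freeness of source and target makes the resulting morphism
bijective. -/

namespace LieMC

/-- A square sum differs from the sum over its lower left triangle by terms above the
diagonal. -/
theorem sum_square_sub_sum_antidiagonal_mem {k : Type*} {M : Type*} [Semiring k] [AddCommGroup M]
    [Module k M] (S : Submodule k M) (f : ℕ → ℕ → M) (n : ℕ)
    (h : ∀ i j, n ≤ i + j → f i j ∈ S) :
    ∑ i ∈ Finset.range n, ∑ j ∈ Finset.range n, f i j -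
      ∑ m ∈ Finset.range n, ∑ ij ∈ Finset.HasAntidiagonal.antidiagonal m, f ij.1 ij.2 ∈ S := by
  classical
  have h1 : ∑ m ∈ Finset.range n, ∑ ij ∈ Finset.HasAntidiagonal.antidiagonal m, f ij.1 ij.2 =
      ∑ ij ∈ (Finset.range n ×ˢ Finset.range n).filter (fun ij => ij.1 + ij.2 < n),
        f ij.1 ij.2 := by
    rw [← Finset.sum_fiberwise_of_maps_to (t := Finset.range n)
      (g := fun ij : ℕ × ℕ => ij.1 + ij.2)]
    · refine Finset.sum_congr rfl fun m hm => Finset.sum_congr ?_ fun _ _ => rfl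
      ext ⟨i, j⟩
      simp at hm ⊢
      omega
    · intro ij hij
      simpa using (Finset.mem_filter.1 hij).2
  rw [h1, ← Finset.sum_product', ← Finset.sum_filter_add_sum_filter_not
    (Finset.range n ×ˢ Finset.range n) (fun ij => ij.1 + ij.2 < n), add_sub_cancel_left]
  refine Submodule.sum_mem _ fun ij hij => h _ _ ?_
  simpa using (Finset.mem_filter.1 hij).2

/-! ### The canonical filtration and the linear flow equation. -/

namespace GradedLie

variable {k : Type u} [Field k] {L M : GradedLie k}

theorem F_anti {m n : ℕ} (h : m ≤ n) (p : ℤ) : L.F n p ≤ L.F m p :=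
  Submodule.span_mono fun _ ⟨l, hl, hx⟩ => ⟨l, h.trans hl, hx⟩

theorem mem_F_one {p : ℤ} (x : L.V p) : x ∈ L.F 1 p :=
  Submodule.subset_span ⟨1, le_rfl, .elem x⟩

theorem bracket_mem_F {m n : ℕ} {p q r : ℤ} (h : p + q = r) {x : L.V p} {y : L.V q}
    (hx : x ∈ L.F m p) (hy : y ∈ L.F n q) : L.bracket h x y ∈ L.F (m + n) r := by
  have := Submodule.apply_mem_map₂ (L.bracket h) hx hy
  rw [F, F, Submodule.map₂_span_span] at this
  refine Submodule.span_mono ?_ this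
  rintro _ ⟨x, ⟨i, hi, hx⟩, y, ⟨j, hj, hy⟩, rfl⟩
  exact ⟨i + j, by omega, .bracket h hx hy⟩

theorem bracket_mem_F_left {m : ℕ} {p q r : ℤ} (h : p + q = r) {x : L.V p} (y : L.V q)
    (hx : x ∈ L.F m p) : L.bracket h x y ∈ L.F m r :=
  F_anti (by omega) _ (bracket_mem_F h hx (mem_F_one y))

theorem bracket_mem_F_right {m : ℕ} {p q r : ℤ} (h : p + q = r) (x : L.V p) {y : L.V q}
    (hy : y ∈ L.F m q) : L.bracket h x y ∈ L.F m r :=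
  F_anti (by omega) _ (bracket_mem_F h (mem_F_one x) hy)

theorem IsBracketing.map (φ : Hom L M) {n : ℕ} {p : ℤ} {x : L.V p} (hx : L.IsBracketing n x) :
    M.IsBracketing n (φ.f p x) := by
  induction hx with
  | elem x => exact .elem _
  | bracket h _ _ hx hy => rw [φ.map_bracket]; exact .bracket h hx hy

theorem Hom.map_mem_F (φ : Hom L M) {n : ℕ} {p : ℤ} {x : L.V p} (hx : x ∈ L.F n p) :
    φ.f p x ∈ M.F n p := by
  have := Submodule.mem_map_of_mem (f := φ.f p) hx
  rw [F, Submodule.map_span] at this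
  refine Submodule.span_mono ?_ this
  rintro _ ⟨x, ⟨i, hi, hx⟩, rfl⟩
  exact ⟨i, hi, hx.map φ⟩

theorem IsComplete.eq_of_sub_mem (hL : L.IsComplete) {p : ℤ} {x y : L.V p}
    (h : ∀ n, x - y ∈ L.F n p) : x = y :=
  sub_eq_zero.1 ((hL p).1 _ h)

/-- The linear flow equation `r' = u - [x, r]`, `r(0) = 0`, has a solution with `r(1) = 0` only
for `u = 0`. -/
theorem IsComplete.eq_zero_of_flow (hL : L.IsComplete) [CharZero k] {p : ℤ} (x : L.V 0) (u : L.V p)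
    (r : ℕ → L.V p) (h0 : r 0 = 0)
    (hr : ∀ n : ℕ, ((n + 1 : ℕ) : k) • r (n + 1) =
      (if n = 0 then u else 0) - L.bracket (zero_add p) x (r n))
    (hs : ∀ N : ℕ, ∃ K : ℕ, ∀ n ≥ K, ∑ m ∈ Finset.range n, r m ∈ L.F N p) : u = 0 := by
  have hr1 : r 1 = u := by
    have := hr 0
    simpa [h0] using this
  have hr2 : ∀ n, r (n + 2) = -(((n + 2 : ℕ) : k)⁻¹ • L.bracket (zero_add p) x (r (n + 1))) := by
    intro n
    have h := hr (n + 1)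
    rw [if_neg (Nat.succ_ne_zero n), zero_sub] at h
    have hn : ((n + 2 : ℕ) : k) ≠ 0 := by exact_mod_cast Nat.succ_ne_zero (n + 1)
    rw [← smul_neg, ← h, smul_smul, inv_mul_cancel₀ hn, one_smul]
  -- If u lies in F_N, then so does every coefficient of r, and those from index 2 on, being
  -- brackets with x, lie in F_{N+1}. The remaining part of a partial sum is r 0 + r 1 = u, so u
  -- lies in F_{N+1} as well; completeness then gives u = 0.
  refine (hL p).1 u fun N => ?_
  induction N with
  | zero => exact F_anti (Nat.zero_le 1) _ (mem_F_one u)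
  | succ N ih =>
    have h1 : ∀ n, r (n + 1) ∈ L.F N p := by
      intro n
      induction n with
      | zero => rw [hr1]; exact ih
      | succ n hn =>
        rw [hr2]
        exact neg_mem (Submodule.smul_mem _ _ (bracket_mem_F_right _ _ hn))
    have h2 : ∀ n, r (n + 2) ∈ L.F (N + 1) p := by
      intro n
      rw [hr2, add_comm N]
      exact neg_mem (Submodule.smul_mem _ _ (bracket_mem_F _ (mem_F_one x) (h1 n)))
    obtain ⟨K, hK⟩ := hs (N + 1)
    have h3 := hK (K + 2) (by omega)
    rw [Finset.sum_range_succ', Finset.sum_range_succ', h0, hr1, add_zero] at h3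
    exact (Submodule.add_mem_iff_right _ (Submodule.sum_mem _ fun n _ => h2 n)).1 h3

end GradedLie

/-- The Leibniz rule differentiates one bracketed element at a time, so the number of elements in a
bracketing does not drop. -/
theorem DerLie.d_mem_F {k : Type u} [Field k] {L : DerLie k} {n : ℕ} {p q : ℤ} (h : p + 1 = q)
    {x : L.V p} (hx : x ∈ L.F n p) : L.d h x ∈ L.F n q := by
  have key : ∀ {n : ℕ} {p : ℤ} {x : L.V p}, L.IsBracketing n x →
      ∀ {q : ℤ} (h : p + 1 = q), L.d h x ∈ L.F n q := by
    intro n p x hx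
    induction hx with
    | elem x => intro q h; exact GradedLie.mem_F_one _
    | @bracket m n p q r h x y hx hy ihx ihy =>
      intro t ht
      rw [L.leibniz h ht rfl (by omega) rfl (by omega)]
      exact add_mem (GradedLie.bracket_mem_F _ (ihx rfl) (Submodule.subset_span ⟨n, le_rfl, hy⟩))
        (Submodule.smul_mem _ _
          (GradedLie.bracket_mem_F _ (Submodule.subset_span ⟨m, le_rfl, hx⟩) (ihy rfl)))
  rw [GradedLie.F] at hx
  induction hx using Submodule.span_induction with
  | zero => simp
  | add x y _ _ hx hy => rw [map_add]; exact add_mem hx hy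
  | smul c x _ hx => rw [map_smul]; exact Submodule.smul_mem _ _ hx
  | mem x hx =>
    obtain ⟨m, hm, hx⟩ := hx
    exact GradedLie.F_anti hm _ (key hx h)

/-! ### Word length and the canonical filtration of the free Lie algebra. -/

/-- The graded commutator `a b - (-1)^n b a` of elements with product of degrees `n`. -/
def gradedComm (k : Type u) [Field k] (A : Type*) [Ring A] [Algebra k A] (n : ℤ) :
    A →ₗ[k] A →ₗ[k] A :=
  LinearMap.mul k A - sgn k n • (LinearMap.mul k A).flip

theorem gradedComm_apply {k : Type u} [Field k] {A : Type*} [Ring A] [Algebra k A] (n : ℤ)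
    (a b : A) : gradedComm k A n a b = a * b - sgn k n • (b * a) := rfl

section Free

variable {k : Type u} [Field k] {I : Type} (deg : I → ℤ)

theorem coeff_succ_monomial_one_mul {A : Type*} [Semiring A] (m : ℕ) (a : A) (G : PowerSeries A) :
    PowerSeries.coeff (m + 1) (PowerSeries.monomial 1 a * G) = a * PowerSeries.coeff m G := by
  rw [PowerSeries.coeff_mul, Finset.sum_eq_single (1, m)]
  · rw [PowerSeries.coeff_monomial_same]
  · rintro ⟨x, y⟩ h hne
    have := Finset.HasAntidiagonal.mem_antidiagonal.1 h
    rw [PowerSeries.coeff_monomial, if_neg, zero_mul]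
    rintro rfl
    exact hne (Prod.ext rfl (by simp at this ⊢; omega))
  · intro h; exact (h (Finset.HasAntidiagonal.mem_antidiagonal.2 (add_comm _ _))).elim

theorem coeff_succ_mul_monomial_one {A : Type*} [Semiring A] (m : ℕ) (a : A) (G : PowerSeries A) :
    PowerSeries.coeff (m + 1) (G * PowerSeries.monomial 1 a) = PowerSeries.coeff m G * a := by
  rw [PowerSeries.coeff_mul, Finset.sum_eq_single (m, 1)]
  · rw [PowerSeries.coeff_monomial_same]
  · rintro ⟨x, y⟩ h hne
    have := Finset.HasAntidiagonal.mem_antidiagonal.1 h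
    rw [PowerSeries.coeff_monomial, if_neg, mul_zero]
    rintro rfl
    exact hne (Prod.ext (by simp at this ⊢; omega) rfl)
  · intro h; exact (h (Finset.HasAntidiagonal.mem_antidiagonal.2 rfl)).elim

theorem treeLie_mem (t : FreeMagma I) : treeLie k deg t ∈ liePoly k deg t.length (treeDeg deg t) :=
  Submodule.subset_span ⟨t, rfl, rfl, rfl⟩

theorem freeLie_bracket_coe {p q r : ℤ} (h : p + q = r) (F : (freeLie k deg).V p)
    (G : (freeLie k deg).V q) :
    ((freeLie k deg).bracket h F G).1 = F.1 * G.1 - sgn k (p * q) • (G.1 * F.1) := rfl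

theorem coeff_freeLie_bracket {p q r : ℤ} (h : p + q = r) (F : (freeLie k deg).V p)
    (G : (freeLie k deg).V q) (n : ℕ) :
    PowerSeries.coeff n ((freeLie k deg).bracket h F G).1 =
      ∑ ij ∈ Finset.HasAntidiagonal.antidiagonal n, (gradedComm k (FreeAlgebra k I) (p * q)
        (PowerSeries.coeff ij.1 F.1) (PowerSeries.coeff ij.2 G.1)) := by
  rw [freeLie_bracket_coe, map_sub, coeff_smul', PowerSeries.coeff_mul, PowerSeries.coeff_mul,
    ← Finset.Nat.sum_antidiagonal_swap (f := fun ij => PowerSeries.coeff ij.1 G.1 * _),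
    Finset.smul_sum, ← Finset.sum_sub_distrib]
  rfl

theorem coeff_zero_lieHat {p : ℤ} (F : lieHat k deg p) : PowerSeries.coeff 0 F.1 = 0 := by
  have := F.2 0
  rwa [liePoly_zero] at this

/-- Elements have no constant term and word lengths add under the bracket, so each bracketed element
contributes at least one letter. -/
theorem coeff_eq_zero_of_isBracketing {n : ℕ} {p : ℤ} {F : (freeLie k deg).V p}
    (hF : (freeLie k deg).IsBracketing n F) : ∀ m < n, PowerSeries.coeff m F.1 = 0 := by
  induction hF with
  | elem F =>
    intro m hm
    obtain rfl : m = 0 := by omega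
    exact coeff_zero_lieHat deg F
  | @bracket m n p q r h x y _ _ hx hy =>
    intro l hl
    rw [coeff_freeLie_bracket]
    refine Finset.sum_eq_zero fun ij hij => ?_
    have := Finset.HasAntidiagonal.mem_antidiagonal.1 hij
    by_cases h1 : ij.1 < m
    · rw [hx _ h1, map_zero, LinearMap.zero_apply]
    · rw [hy ij.2 (by omega), map_zero]

theorem coeff_eq_zero_of_mem_F {n : ℕ} {p : ℤ} {F : (freeLie k deg).V p}
    (hF : F ∈ (freeLie k deg).F n p) : ∀ m < n, PowerSeries.coeff m F.1 = 0 := by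
  intro m hm
  rw [GradedLie.F] at hF
  induction hF using Submodule.span_induction with
  | zero => exact map_zero _
  | add F G _ _ hF hG => exact (map_add _ F.1 G.1).trans (by rw [hF, hG, add_zero])
  | smul c F _ hF => exact (coeff_smul' c m F.1).trans (by rw [hF, smul_zero])
  | mem F hF =>
    obtain ⟨l, hl, hF⟩ := hF
    exact coeff_eq_zero_of_isBracketing deg hF m (by omega)

theorem monomial_mem_lieHat {n : ℕ} {p : ℤ} {a : FreeAlgebra k I} (ha : a ∈ liePoly k deg n p) :
    PowerSeries.monomial n a ∈ lieHat k deg p := by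
  intro m
  rw [PowerSeries.coeff_monomial]
  split_ifs with h
  · subst h; exact ha
  · exact zero_mem _

/-- A homogeneous Lie polynomial as an element of the free complete graded Lie algebra. -/
noncomputable def lieMonomial {n : ℕ} {p : ℤ} {a : FreeAlgebra k I} (ha : a ∈ liePoly k deg n p) :
    (freeLie k deg).V p :=
  ⟨PowerSeries.monomial n a, monomial_mem_lieHat deg ha⟩

section Finite

variable [Fintype I]

variable (k) in
/-- The span of the brackets of a generator with a Lie polynomial of length `n`, in degree `p`. -/
def genBracket (n : ℕ) (p : ℤ) : Submodule k (FreeAlgebra k I) :=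
  (Submodule.pi Set.univ fun i => liePoly k deg n (p - deg i)).map
    (∑ i, gradedComm k (FreeAlgebra k I) (deg i * (p - deg i)) (FreeAlgebra.ι k i) ∘ₗ
      LinearMap.proj i)

theorem mem_genBracket {n : ℕ} {p : ℤ} {a : FreeAlgebra k I} (ha : a ∈ genBracket k deg n p) :
    ∃ g : I → FreeAlgebra k I, (∀ i, g i ∈ liePoly k deg n (p - deg i)) ∧
      a = ∑ i, gradedComm k (FreeAlgebra k I) (deg i * (p - deg i)) (FreeAlgebra.ι k i) (g i) := by
  obtain ⟨g, hg, rfl⟩ := ha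
  exact ⟨g, fun i => hg i trivial, by simp⟩

theorem gradedComm_ι_mem {n : ℕ} {q : ℤ} {b : FreeAlgebra k I} (hb : b ∈ liePoly k deg n q)
    (i : I) : gradedComm k (FreeAlgebra k I) (deg i * q) (FreeAlgebra.ι k i) b ∈
      genBracket k deg n (deg i + q) := by
  classical
  refine ⟨Pi.single i b, fun j _ => ?_, ?_⟩
  · by_cases h : j = i
    · subst h; simpa using hb
    · simp [h]
  · rw [LinearMap.sum_apply, Finset.sum_eq_single i]
    · simp
    · intro j _ hj; simp [hj]
    · simp

/-- The Jacobi identity in the form [[s, t], b] = [s, [t, b]] - (±)[t, [s, b]] moves the brackets to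
the right. The induction is on the left factor, with b arbitrary because it is replaced by [t, b]
and [s, b]. -/
theorem gradedComm_treeLie_mem (s : FreeMagma I) : ∀ {n : ℕ} {q : ℤ} {b : FreeAlgebra k I},
    b ∈ liePoly k deg n q → gradedComm k (FreeAlgebra k I) (treeDeg deg s * q) (treeLie k deg s) b ∈
      genBracket k deg (s.length + n - 1) (treeDeg deg s + q) := by
  induction s with
  | ih1 i =>
    intro n q b hb
    have : (FreeMagma.of i).length + n - 1 = n := by simp [FreeMagma.length]
    rw [this]
    exact gradedComm_ι_mem deg hb i
  | ih2 s t hs ht =>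
    intro n q b hb
    have e1 := hs (liePoly_bracket deg (treeLie_mem deg t) hb)
    have e2 := ht (liePoly_bracket deg (treeLie_mem deg s) hb)
    have ps := s.length_pos
    have pt := t.length_pos
    have l1 : s.length + (t.length + n) - 1 = (s * t).length + n - 1 := by
      change _ = s.length + t.length + n - 1; omega
    have l2 : t.length + (s.length + n) - 1 = (s * t).length + n - 1 := by
      change _ = s.length + t.length + n - 1; omega
    have d1 : treeDeg deg s + (treeDeg deg t + q) = treeDeg deg (s * t) + q := by
      rw [treeDeg_mul]; ring
    have d2 : treeDeg deg t + (treeDeg deg s + q) = treeDeg deg (s * t) + q := by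
      rw [treeDeg_mul]; ring
    rw [l1, d1] at e1
    rw [l2, d2] at e2
    convert sub_mem e1 (Submodule.smul_mem _ (sgn k (treeDeg deg s * treeDeg deg t)) e2) using 1
    simp only [gradedComm_apply, treeLie_mul, treeDeg_mul, add_mul, mul_add, sgn_add,
      mul_comm (treeDeg deg t) (treeDeg deg s)]
    rcases sgn_eq k (treeDeg deg s * treeDeg deg t) with h | h <;>
      rcases sgn_eq k (treeDeg deg s * q) with h' | h' <;>
      rcases sgn_eq k (treeDeg deg t * q) with h'' | h'' <;>
      simp only [h, h', h'', one_smul, neg_smul, mul_one, mul_neg, neg_neg] <;> noncomm_ring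

theorem liePoly_le_genBracket (n : ℕ) (p : ℤ) :
    liePoly k deg (n + 2) p ≤ genBracket k deg (n + 1) p := by
  rw [liePoly, Submodule.span_le]
  rintro _ ⟨t, ht, rfl, rfl⟩
  cases t with
  | of i => simp [FreeMagma.length] at ht
  | mul s t =>
    have := gradedComm_treeLie_mem deg s (treeLie_mem (k := k) deg t)
    have h : s.length + t.length - 1 = n + 1 := by
      change s.length + t.length = n + 2 at ht; omega
    rw [h] at this
    exact this

/-- A series has infinitely many components, whereas F_n is a span of finite sums. Splitting off the
outermost generator in all word lengths at once writes the series as a sum of brackets [xᵢ, Gᵢ],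
which is finite because there are finitely many generators. -/
theorem mem_F_of_coeff_eq_zero : ∀ (n : ℕ) {p : ℤ} (F : (freeLie k deg).V p),
    (∀ m < n, PowerSeries.coeff m F.1 = 0) → F ∈ (freeLie k deg).F n p := by
  intro n
  induction n with
  | zero => intro p F _; exact GradedLie.F_anti (Nat.zero_le 1) _ (GradedLie.mem_F_one F)
  | succ n ih =>
    intro p F hF
    rcases Nat.eq_zero_or_pos n with rfl | hn
    · exact GradedLie.mem_F_one F
    have key : ∀ m, ∃ g : I → FreeAlgebra k I, (∀ i, g i ∈ liePoly k deg m (p - deg i)) ∧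
        (m < n → ∀ i, g i = 0) ∧ PowerSeries.coeff (m + 1) F.1 = ∑ i,
          gradedComm k (FreeAlgebra k I) (deg i * (p - deg i)) (FreeAlgebra.ι k i) (g i) := by
      intro m
      by_cases hm : m < n
      -- Choosing zero where the component of F vanishes makes each Gᵢ start at word length n, as
      -- the induction hypothesis requires.
      · exact ⟨0, fun i => zero_mem _, fun _ _ => rfl, by rw [hF _ (by omega)]; simp⟩
      · obtain ⟨l, rfl⟩ : ∃ l, m = l + 1 := ⟨m - 1, by omega⟩
        obtain ⟨g, hg, h⟩ := mem_genBracket deg (liePoly_le_genBracket deg l p (F.2 (l + 2)))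
        exact ⟨g, hg, fun h => absurd h hm, h⟩
    choose g hg hg0 hgF using key
    have hG : ∀ i, (PowerSeries.mk fun m => g m i) ∈ lieHat k deg (p - deg i) := fun i m => by
      rw [PowerSeries.coeff_mk]; exact hg m i
    let G : ∀ i, (freeLie k deg).V (p - deg i) := fun i => ⟨_, hG i⟩
    have hsum : F = ∑ i, (freeLie k deg).bracket (add_sub_cancel _ _) (lieGen k deg i) (G i) := by
      refine Subtype.ext ?_
      rw [show ((∑ i, (freeLie k deg).bracket (add_sub_cancel _ _) (lieGen k deg i) (G i) :
        (freeLie k deg).V p)).1 = ∑ i, ((freeLie k deg).bracket (add_sub_cancel _ _)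
          (lieGen k deg i) (G i)).1 from AddSubmonoidClass.coe_finsetSum _ _]
      ext1 m
      rw [map_sum]
      rcases m with _ | m
      · refine (coeff_zero_lieHat deg F).trans ?_
        exact (Finset.sum_eq_zero fun i _ => coeff_zero_lieHat deg _).symm
      · rw [hgF]
        refine Finset.sum_congr rfl fun i _ => ?_
        rw [freeLie_bracket_coe, map_sub, coeff_smul', gradedComm_apply]
        change _ = PowerSeries.coeff (m + 1) (PowerSeries.monomial 1 (FreeAlgebra.ι k i) * _) -
          _ • PowerSeries.coeff (m + 1) (_ * PowerSeries.monomial 1 (FreeAlgebra.ι k i))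
        rw [coeff_succ_monomial_one_mul, coeff_succ_mul_monomial_one]
        simp only [G, PowerSeries.coeff_mk]
    rw [hsum]
    refine Submodule.sum_mem _ fun i _ => ?_
    rw [add_comm n]
    refine GradedLie.bracket_mem_F _ (GradedLie.mem_F_one _) (ih _ fun m hm => ?_)
    change PowerSeries.coeff m (PowerSeries.mk fun m => g m i) = 0
    rw [PowerSeries.coeff_mk, hg0 m hm]

/-- Both halves reduce to coefficients, because the canonical filtration is the word length
filtration. The coefficient of length m of a compatible sequence is stable from index m + 1 on, and
the limit is read off there. -/
theorem freeLie_isComplete : (freeLie k deg).IsComplete := by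
  refine fun p => ⟨fun F hF => Subtype.ext ?_, fun s hs => ?_⟩
  · ext1 m
    exact coeff_eq_zero_of_mem_F deg (hF (m + 1)) m (Nat.lt_succ_self m)
  · have hs' : ∀ n, ∀ m < n, PowerSeries.coeff m (s (n + 1)).1 = PowerSeries.coeff m (s n).1 := by
      intro n m hm
      have := coeff_eq_zero_of_mem_F deg (hs n) m hm
      exact sub_eq_zero.1 ((map_sub (PowerSeries.coeff m) (s (n + 1)).1 (s n).1).symm.trans this)
    have hs2 : ∀ m n, m < n → PowerSeries.coeff m (s n).1 = PowerSeries.coeff m (s (m + 1)).1 := by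
      intro m n hmn
      induction n, hmn using Nat.le_induction with
      | base => rfl
      | succ n hn ih => rw [hs' n m hn, ih]
    refine ⟨⟨PowerSeries.mk fun m => PowerSeries.coeff m (s (m + 1)).1, fun m => ?_⟩, fun n => ?_⟩
    · rw [PowerSeries.coeff_mk]; exact (s (m + 1)).2 m
    · refine mem_F_of_coeff_eq_zero deg n _ fun m hm => ?_
      refine (map_sub (PowerSeries.coeff m) _ (s n).1).trans ?_
      rw [PowerSeries.coeff_mk, hs2 m n hm, sub_self]

/-- A family of subspaces that is closed under brackets and contains the generators is dense. -/
theorem exists_sub_mem_F (K : ∀ p, Submodule k ((freeLie k deg).V p))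
    (hgen : ∀ i, lieGen k deg i ∈ K (deg i))
    (hbr : ∀ {p q r : ℤ} (h : p + q = r) (x : (freeLie k deg).V p) (y : (freeLie k deg).V q),
      x ∈ K p → y ∈ K q → (freeLie k deg).bracket h x y ∈ K r)
    {p : ℤ} (x : (freeLie k deg).V p) (n : ℕ) : ∃ y ∈ K p, x - y ∈ (freeLie k deg).F n p := by
  have tree : ∀ t : FreeMagma I, lieMonomial deg (treeLie_mem (k := k) deg t) ∈ K _ := by
    intro t
    induction t with
    | ih1 i => exact hgen i
    | ih2 s t hs ht =>
      have e : lieMonomial deg (treeLie_mem (k := k) deg (s * t)) = (freeLie k deg).bracket rfl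
          (lieMonomial deg (treeLie_mem deg s)) (lieMonomial deg (treeLie_mem deg t)) := by
        refine Subtype.ext ?_
        rw [freeLie_bracket_coe]
        change PowerSeries.monomial (s.length + t.length) _ =
          PowerSeries.monomial _ _ * PowerSeries.monomial _ _ - _ •
            (PowerSeries.monomial _ _ * PowerSeries.monomial _ _)
        rw [PowerSeries.monomial_mul_monomial, PowerSeries.monomial_mul_monomial, smul_monomial,
          treeLie_mul, map_sub, add_comm t.length]
      exact (congrArg (· ∈ K _) e).mpr (hbr rfl _ _ hs ht)
  have poly : ∀ (m : ℕ) (a : FreeAlgebra k I) (ha : a ∈ liePoly k deg m p),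
      lieMonomial deg ha ∈ K p := by
    intro m a ha
    induction ha using Submodule.span_induction with
    | zero => exact (congrArg (· ∈ K p) (Subtype.ext (map_zero _))).mpr (zero_mem (K p))
    | add a b ha hb iha ihb =>
      exact (congrArg (· ∈ K p) (Subtype.ext (map_add _ _ _))).mpr (add_mem iha ihb)
    | smul c a ha iha =>
      exact (congrArg (· ∈ K p) (Subtype.ext (smul_monomial _ _ _).symm)).mpr
        (Submodule.smul_mem _ c iha)
    | mem a ha =>
      obtain ⟨t, rfl, rfl, rfl⟩ := ha
      exact tree t
  induction n with
  | zero =>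
    exact ⟨0, zero_mem _, GradedLie.F_anti (Nat.zero_le 1) _ (GradedLie.mem_F_one _)⟩
  | succ n ih =>
    obtain ⟨y, hy, hxy⟩ := ih
    -- The error x - y starts at word length n; its component of that length is a Lie polynomial, so
    -- it lies in K and can be added to y.
    refine ⟨y + lieMonomial deg ((x - y).2 n), add_mem hy (poly _ _ _), ?_⟩
    rw [← sub_sub]
    refine mem_F_of_coeff_eq_zero deg _ _ fun m hm => ?_
    refine (map_sub (PowerSeries.coeff m) (x - y).1 _).trans ?_
    change _ - PowerSeries.coeff m (PowerSeries.monomial n _) = 0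
    rw [PowerSeries.coeff_monomial]
    split_ifs with h
    · rw [h, sub_self]
    · rw [coeff_eq_zero_of_mem_F deg hxy m (by omega), sub_zero]

/-- A filtered family of linear maps out of the free complete Lie algebra vanishes if it vanishes
on the generators and its kernel is closed under brackets. -/
theorem eq_zero_of_eq_zero_on_gen {M : GradedLie k} (hM : M.IsComplete) {σ : ℤ → ℤ}
    (T : ∀ p, (freeLie k deg).V p →ₗ[k] M.V (σ p))
    (hgen : ∀ i, T _ (lieGen k deg i) = 0)
    (hbr : ∀ {p q r : ℤ} (h : p + q = r) (x : (freeLie k deg).V p) (y : (freeLie k deg).V q),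
      T p x = 0 → T q y = 0 → T r ((freeLie k deg).bracket h x y) = 0)
    (hF : ∀ {n p} {x : (freeLie k deg).V p}, x ∈ (freeLie k deg).F n p → T p x ∈ M.F n (σ p))
    {p : ℤ} (x : (freeLie k deg).V p) : T p x = 0 := by
  refine (hM _).1 _ fun n => ?_
  obtain ⟨y, hy, hxy⟩ := exists_sub_mem_F deg (fun p => LinearMap.ker (T p)) hgen hbr x n
  have := hF hxy
  rwa [map_sub, LinearMap.mem_ker.1 hy, sub_zero] at this

end Finite

end Free

/-! ### Evaluation of Lie series by the Dynkin–Specht–Wever formula. -/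

namespace GradedLie

variable {k : Type u} [Field k] (M : GradedLie k)

/-- The adjoint action of a homogeneous element on the product of all components. -/
def adPi {p : ℤ} : M.V p →ₗ[k] Module.End k (∀ r, M.V r) where
  toFun x := LinearMap.pi fun r =>
    M.bracket (add_sub_cancel p r) x ∘ₗ LinearMap.proj (r - p)
  map_add' x y := by ext f r; simp
  map_smul' c x := by ext f r; simp

variable {M}

theorem bracket_congr {p q q' r : ℤ} (e : q = q') (h : p + q = r) (h' : p + q' = r) (x : M.V p)
    (f : ∀ r, M.V r) : M.bracket h x (f q) = M.bracket h' x (f q') := by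
  subst e; rfl

theorem adPi_apply {p q r : ℤ} (h : p + q = r) (x : M.V p) (f : ∀ r, M.V r) :
    M.adPi x f r = M.bracket h x (f q) :=
  bracket_congr (by omega) _ _ x f

theorem adPi_single {p q : ℤ} (x : M.V p) (y : M.V q) :
    M.adPi x (Pi.single q y) = Pi.single (p + q) (M.bracket rfl x y) := by
  ext r
  by_cases h : r = p + q
  · subst h
    rw [adPi_apply rfl, Pi.single_eq_same, Pi.single_eq_same]
  · rw [adPi_apply (add_sub_cancel p r), Pi.single_eq_of_ne h, Pi.single_eq_of_ne (by omega),
      map_zero]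

theorem single_bracket_swap {p q : ℤ} (x : M.V p) (y : M.V q) :
    (Pi.single (q + p) (M.bracket rfl y x) : ∀ r, M.V r) =
      -(sgn k (p * q) • Pi.single (p + q) (M.bracket rfl x y)) := by
  rw [← adPi_single]
  ext r
  rw [Pi.neg_apply, Pi.smul_apply]
  by_cases h : r = p + q
  · subst h
    rw [adPi_apply (add_comm q p), Pi.single_eq_same, Pi.single_eq_same, M.antisymm _ rfl,
      mul_comm q]
  · rw [adPi_single, Pi.single_eq_of_ne h, smul_zero, neg_zero, Pi.single_eq_of_ne]
    omega

/-- This is the Jacobi identity: the adjoint action turns brackets into graded commutators of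
operators. -/
theorem adPi_bracket {p q : ℤ} (x : M.V p) (y : M.V q) (f : ∀ r, M.V r) :
    M.adPi (M.bracket rfl x y) f =
      M.adPi x (M.adPi y f) - sgn k (p * q) • M.adPi y (M.adPi x f) := by
  ext r
  have e : p + (q + (r - p - q)) = r := by omega
  have e' : q + (p + (r - p - q)) = r := by omega
  have e2 : p + q + (r - p - q) = r := by omega
  rw [Pi.sub_apply, Pi.smul_apply, adPi_apply e2, adPi_apply e, adPi_apply rfl, adPi_apply e',
    adPi_apply rfl, M.jacobi rfl e rfl e2 rfl e', add_sub_cancel_right]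

end GradedLie

section Eval

variable {k : Type u} [Field k] {I : Type} (deg : I → ℤ) {M : GradedLie k}
  (y : ∀ i, M.V (deg i))

/-- The value of a bracketing of generators in a graded Lie algebra. -/
def treeEval : ∀ t : FreeMagma I, M.V (treeDeg deg t)
  | .of i => y i
  | .mul s t => M.bracket rfl (treeEval s) (treeEval t)

theorem treeEval_mem_F (t : FreeMagma I) : treeEval deg y t ∈ M.F t.length _ := by
  induction t with
  | ih1 i => exact GradedLie.mem_F_one _
  | ih2 s t hs ht => exact GradedLie.bracket_mem_F _ hs ht

/-- The action of the generators on `k × M` by `(c, f) ↦ (0, c y_i + [y_i, f])`. Applied to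
`(1, 0)`, a word of generators gives the right-normed bracket of the `y_i`. -/
noncomputable def dynkinRep : FreeAlgebra k I →ₐ[k] Module.End k (k × ∀ r, M.V r) :=
  FreeAlgebra.lift k fun i => LinearMap.inr k k _ ∘ₗ
    (LinearMap.toSpanSingleton k _ (Pi.single (deg i) (y i)) ∘ₗ LinearMap.fst k k _ +
      M.adPi (y i) ∘ₗ LinearMap.snd k k _)

/-- The Dynkin–Specht–Wever formula. For a bracket of s and t, one order of composition contributes
|t| [s, t] and the other contributes -(±)|s| [t, s], which is |s| [s, t] by antisymmetry; the
lengths add up. Carrying the second component f along makes the statement strong enough for the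
induction. -/
theorem dynkinRep_treeLie (t : FreeMagma I) (c : k) (f : ∀ r, M.V r) :
    dynkinRep deg y (treeLie k deg t) (c, f) =
      (0, (c * t.length) • Pi.single (treeDeg deg t) (treeEval deg y t) +
        M.adPi (treeEval deg y t) f) := by
  induction t generalizing c f with
  | ih1 i =>
    simp [dynkinRep, treeEval, FreeMagma.length]
    rfl
  | ih2 s t hs ht =>
    rw [treeLie_mul, map_sub, map_smul, map_mul, map_mul, LinearMap.sub_apply,
      LinearMap.smul_apply, Module.End.mul_apply, Module.End.mul_apply, hs, ht, hs, ht]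
    have e2 : ((s * t).length : k) = s.length + t.length := by
      rw [← Nat.cast_add]; rfl
    rw [e2]
    change _ = ((0 : k), (c * (s.length + t.length)) • (Pi.single (treeDeg deg s + treeDeg deg t)
      (M.bracket rfl (treeEval deg y s) (treeEval deg y t)) : ∀ r, M.V r) +
        M.adPi (M.bracket rfl (treeEval deg y s) (treeEval deg y t)) f)
    refine Prod.ext ?_ ?_
    · simp
    · simp only [Prod.snd_sub, Prod.smul_snd, zero_mul, zero_smul, zero_add, map_add, map_smul,
        GradedLie.adPi_single, GradedLie.single_bracket_swap (treeEval deg y s),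
        GradedLie.adPi_bracket, smul_add, smul_neg, mul_add, add_smul]
      rw [smul_comm (sgn k _) (c * (s.length : k)), smul_smul (sgn k _) (sgn k _), sgn_mul_self,
        one_smul]
      abel

/-- The value of a Lie polynomial of length `n` and degree `p`: by the Dynkin--Specht--Wever
formula, replacing words by right-normed brackets multiplies its bracketings by `n`. -/
noncomputable def polyEval (n : ℕ) (p : ℤ) : FreeAlgebra k I →ₗ[k] M.V p :=
  (n : k)⁻¹ • (LinearMap.proj p ∘ₗ LinearMap.snd k k _ ∘ₗ
    LinearMap.applyₗ ((1 : k), (0 : ∀ r, M.V r)) ∘ₗ (dynkinRep deg y).toLinearMap)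

variable [CharZero k]

/-- Division by the length, which is nonzero in characteristic 0, removes the Dynkin factor. As
`polyEval` is linear on the whole free algebra, linear relations between bracketings are respected
automatically. -/
theorem polyEval_treeLie (t : FreeMagma I) :
    polyEval deg y t.length (treeDeg deg t) (treeLie k deg t) = treeEval deg y t := by
  have h : (t.length : k) ≠ 0 := by exact_mod_cast t.length_pos.ne'
  simp [polyEval, dynkinRep_treeLie, h]

theorem polyEval_mem_F {n : ℕ} {p : ℤ} {a : FreeAlgebra k I} (ha : a ∈ liePoly k deg n p) :
    polyEval deg y n p a ∈ M.F n p := by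
  rw [liePoly] at ha
  induction ha using Submodule.span_induction with
  | zero => simp
  | add a b _ _ ha hb => rw [map_add]; exact add_mem ha hb
  | smul c a _ ha => rw [map_smul]; exact Submodule.smul_mem _ _ ha
  | mem a ha =>
    obtain ⟨t, rfl, rfl, rfl⟩ := ha
    rw [polyEval_treeLie]
    exact treeEval_mem_F deg y t

/-- By bilinearity it suffices to take two bracketings, and on these evaluation is multiplicative by
construction. -/
theorem polyEval_bracket {n m l : ℕ} {p q r : ℤ} (hl : n + m = l) (h : p + q = r)
    {a b : FreeAlgebra k I} (ha : a ∈ liePoly k deg n p) (hb : b ∈ liePoly k deg m q) :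
    polyEval deg y l r (gradedComm k (FreeAlgebra k I) (p * q) a b) =
      M.bracket h (polyEval deg y n p a) (polyEval deg y m q b) := by
  subst hl h
  rw [liePoly] at ha hb
  induction ha using Submodule.span_induction with
  | zero => simp
  | add a b _ _ ha hb => simp only [map_add, LinearMap.add_apply, ha, hb]
  | smul c a _ ha => simp only [map_smul, LinearMap.smul_apply, ha]
  | mem a ha =>
    obtain ⟨s, rfl, rfl, rfl⟩ := ha
    induction hb using Submodule.span_induction with
    | zero => simp
    | add a b _ _ ha hb => simp only [map_add, ha, hb]
    | smul c a _ ha => simp only [map_smul, ha]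
    | mem b hb =>
      obtain ⟨t, rfl, rfl, rfl⟩ := hb
      rw [polyEval_treeLie, polyEval_treeLie]
      exact polyEval_treeLie deg y (s * t)

/-- The component of word length m is sent into F_m, so the partial sums form a compatible sequence
and converge. -/
theorem exists_evalHat (hM : M.IsComplete) {p : ℤ} (F : (freeLie k deg).V p) :
    ∃ x : M.V p, ∀ n, x - ∑ m ∈ Finset.range n, polyEval deg y m p (PowerSeries.coeff m F.1) ∈
      M.F n p := by
  refine (hM p).2 _ fun n => ?_
  rw [Finset.sum_range_succ, add_sub_cancel_left]
  exact polyEval_mem_F deg y (F.2 n)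

/-- The value of a Lie series in a complete graded Lie algebra. -/
noncomputable def evalHat (hM : M.IsComplete) {p : ℤ} (F : (freeLie k deg).V p) : M.V p :=
  (exists_evalHat deg y hM F).choose

theorem evalHat_sub_mem (hM : M.IsComplete) {p : ℤ} (F : (freeLie k deg).V p) (n : ℕ) :
    evalHat deg y hM F - ∑ m ∈ Finset.range n, polyEval deg y m p (PowerSeries.coeff m F.1) ∈
      M.F n p :=
  (exists_evalHat deg y hM F).choose_spec n

theorem evalHat_eq (hM : M.IsComplete) {p : ℤ} (F : (freeLie k deg).V p) (x : M.V p)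
    (hx : ∀ n, x - ∑ m ∈ Finset.range n, polyEval deg y m p (PowerSeries.coeff m F.1) ∈
      M.F n p) : evalHat deg y hM F = x := by
  refine hM.eq_of_sub_mem fun n => ?_
  have := sub_mem (evalHat_sub_mem deg y hM F n) (hx n)
  rwa [sub_sub_sub_cancel_right] at this

/-- The morphism out of the free complete graded Lie algebra given by the values of the
generators. -/
noncomputable def evalHom (hM : M.IsComplete) : GradedLie.Hom (freeLie k deg) M where
  f p :=
    { toFun := evalHat deg y hM
      map_add' := fun F G => by
        refine evalHat_eq deg y hM _ _ fun n => ?_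
        have := add_mem (evalHat_sub_mem deg y hM F n) (evalHat_sub_mem deg y hM G n)
        rw [← add_sub_add_comm, ← Finset.sum_add_distrib] at this
        convert this using 3
        rw [← map_add, ← map_add]; rfl
      map_smul' := fun c F => by
        refine evalHat_eq deg y hM _ _ fun n => ?_
        have := Submodule.smul_mem _ c (evalHat_sub_mem deg y hM F n)
        rw [smul_sub, Finset.smul_sum] at this
        refine (congrArg (fun s => c • evalHat deg y hM F - s ∈ M.F n p) ?_).mpr this
        refine Finset.sum_congr rfl fun m _ => ?_
        rw [← map_smul]; rfl }
  map_bracket {p q r} h F G := by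
    refine evalHat_eq deg y hM _ _ fun n => ?_
    change M.bracket h (evalHat deg y hM F) (evalHat deg y hM G) - _ ∈ _
    set u := ∑ m ∈ Finset.range n, polyEval deg y m p (PowerSeries.coeff m F.1) with hu
    set v := ∑ m ∈ Finset.range n, polyEval deg y m q (PowerSeries.coeff m G.1) with hv
    have e1 := GradedLie.bracket_mem_F_left h (evalHat deg y hM G)
      (evalHat_sub_mem deg y hM F n)
    have e2 := GradedLie.bracket_mem_F_right h u (evalHat_sub_mem deg y hM G n)
    rw [← hu, map_sub, LinearMap.sub_apply] at e1
    rw [← hv, map_sub] at e2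
    -- The bracket of two partial sums runs over a square of indices, the partial sum of the bracket
    -- over a triangle; the terms between them have total length at least n.
    have e3 := sum_square_sub_sum_antidiagonal_mem (M.F n r) (fun i j =>
      M.bracket h (polyEval deg y i p (PowerSeries.coeff i F.1))
        (polyEval deg y j q (PowerSeries.coeff j G.1))) n fun i j hij =>
      GradedLie.F_anti hij _ (GradedLie.bracket_mem_F h (polyEval_mem_F deg y (F.2 i))
        (polyEval_mem_F deg y (G.2 j)))
    have e4 : ∑ i ∈ Finset.range n, ∑ j ∈ Finset.range n,
        M.bracket h (polyEval deg y i p (PowerSeries.coeff i F.1))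
        (polyEval deg y j q (PowerSeries.coeff j G.1)) = M.bracket h u v := by
      rw [hu, map_sum (M.bracket h), LinearMap.sum_apply]
      exact Finset.sum_congr rfl fun i _ => (map_sum _ _ _).symm
    rw [e4] at e3
    convert add_mem (add_mem e1 e2) e3 using 1
    rw [sub_add_sub_cancel, sub_add_sub_cancel]
    congr 1
    refine Finset.sum_congr rfl fun m _ => ?_
    rw [coeff_freeLie_bracket, map_sum]
    exact Finset.sum_congr rfl fun ij hij => polyEval_bracket deg y
      (Finset.HasAntidiagonal.mem_antidiagonal.1 hij) h (F.2 _) (G.2 _)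

theorem evalHom_gen (hM : M.IsComplete) (i : I) :
    (evalHom deg y hM).f (deg i) (lieGen k deg i) = y i := by
  refine evalHat_eq deg y hM _ _ fun n => ?_
  rcases Nat.lt_or_ge 1 n with h | h
  · rw [Finset.sum_eq_single 1]
    · have e : polyEval deg y 1 (deg i) (PowerSeries.coeff 1 (lieGen k deg i).1) = y i := by
        change polyEval deg y 1 (deg i)
          (PowerSeries.coeff 1 (PowerSeries.monomial 1 (FreeAlgebra.ι k i))) = y i
        rw [PowerSeries.coeff_monomial_same]
        exact polyEval_treeLie deg y (.of i)
      rw [e, sub_self]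
      exact zero_mem _
    · intro m _ hm
      change polyEval deg y m (deg i)
          (PowerSeries.coeff m (PowerSeries.monomial 1 (FreeAlgebra.ι k i))) = 0
      rw [coeff_mon_ne hm, map_zero]
    · intro h'; exact absurd (Finset.mem_range.2 h) h'
  · exact GradedLie.F_anti h _ (GradedLie.mem_F_one _)

end Eval

/-- Evaluation gives existence. For uniqueness, the difference of two morphisms preserves the
filtration and vanishes on the generators, and elements on which they agree are closed under
brackets, so density applies. -/
theorem freeLie_isFreeCompleteOn (k : Type u) [Field k] [CharZero k] {I : Type} [Fintype I]
    (deg : I → ℤ) : (freeLie k deg).IsFreeCompleteOn deg (lieGen k deg) := by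
  refine ⟨freeLie_isComplete deg, fun M hM y => ⟨evalHom deg y hM, evalHom_gen deg y hM, ?_⟩⟩
  intro φ hφ
  refine GradedLie.Hom.ext (funext fun p => LinearMap.ext fun x => sub_eq_zero.1 ?_)
  refine eq_zero_of_eq_zero_on_gen deg hM (σ := id) (fun p => φ.f p - (evalHom deg y hM).f p)
    (fun i => ?_) (fun {p q r} h x z hx hz => ?_) (fun {n p x} hx => ?_) x
  · exact sub_eq_zero.2 ((hφ i).trans (evalHom_gen deg y hM i).symm)
  · rw [LinearMap.sub_apply, sub_eq_zero] at hx hz ⊢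
    rw [φ.map_bracket, GradedLie.Hom.map_bracket]
    exact congrArg₂ (fun a b => M.bracket h a b) hx hz
  · exact sub_mem (φ.map_mem_F hx) ((evalHom deg y hM).map_mem_F hx)

/-! ### Comparison of free algebras; what Maurer–Cartan elements and gauges impose on d. -/

namespace GradedLie

variable {k : Type u} [Field k] {L M : GradedLie k}

/-- Two complete graded Lie algebras that are free on families of the same degrees are
isomorphic. -/
theorem IsFreeCompleteOn.bijective {I : Type} {deg : I → ℤ} {g : ∀ i, L.V (deg i)}
    {g' : ∀ i, M.V (deg i)} (hL : L.IsFreeCompleteOn deg g) (hM : M.IsFreeCompleteOn deg g')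
    (φ : Hom L M) (hφ : ∀ i, φ.f (deg i) (g i) = g' i) (p : ℤ) : Function.Bijective (φ.f p) := by
  obtain ⟨ψ, hψ, -⟩ := hM.2 L hL.1 g
  let comp {A B C : GradedLie k} (α : Hom A B) (β : Hom B C) : Hom A C :=
    { f := fun p => β.f p ∘ₗ α.f p
      map_bracket := fun h x y => by
        rw [LinearMap.comp_apply, α.map_bracket, β.map_bracket]; rfl }
  let one (A : GradedLie k) : Hom A A := ⟨fun _ => LinearMap.id, fun _ _ _ => rfl⟩
  have e1 : comp φ ψ = one L := (hL.2 L hL.1 g).unique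
    (fun i => (congrArg (ψ.f _) (hφ i)).trans (hψ i)) fun _ => rfl
  have e2 : comp ψ φ = one M := (hM.2 M hM.1 g').unique
    (fun i => (congrArg (φ.f _) (hψ i)).trans (hφ i)) fun _ => rfl
  refine Function.bijective_iff_has_inverse.2 ⟨ψ.f p, fun x => ?_, fun x => ?_⟩
  · exact congrArg (fun χ : Hom L L => χ.f p x) e1
  · exact congrArg (fun χ : Hom M M => χ.f p x) e2

/-- The bracket is symmetric in degree `1`. -/
theorem bracket_one_comm (h : (1 : ℤ) + 1 = 2) (x y : L.V 1) :
    L.bracket h x y = L.bracket h y x := by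
  rw [L.antisymm h h, one_mul, sgn_one, neg_smul, one_smul, neg_neg]

end GradedLie

namespace DerLie

variable {k : Type u} [Field k] {L M : DerLie k}

/-- The square of an odd derivation is a derivation: the two mixed terms [dx, dy] carry the opposite
signs (-1)^(p+1) and (-1)^p. -/
theorem d_d_bracket_eq_zero {p q r s t : ℤ} (h : p + q = r) (hs : r + 1 = s) (ht : s + 1 = t)
    (x : L.V p) (y : L.V q) (hx : L.d (rfl : p + 1 + 1 = _) (L.d rfl x) = 0)
    (hy : L.d (rfl : q + 1 + 1 = _) (L.d rfl y) = 0) : L.d ht (L.d hs (L.bracket h x y)) = 0 := by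
  rw [L.leibniz h hs rfl (by omega) rfl (by omega), map_add, map_smul,
    L.leibniz _ ht rfl (by omega) rfl (by omega), hx,
    L.leibniz _ ht rfl (by omega) rfl (by omega), hy]
  simp [sgn_add]

theorem map_d_bracket (φ : GradedLie.Hom L.toGradedLie M.toGradedLie) {p q r t : ℤ}
    (h : p + q = r) (ht : r + 1 = t) (x : L.V p) (y : L.V q)
    (hx : φ.f (p + 1) (L.d rfl x) = M.d rfl (φ.f p x))
    (hy : φ.f (q + 1) (L.d rfl y) = M.d rfl (φ.f q y)) :
    φ.f t (L.d ht (L.bracket h x y)) = M.d ht (φ.f r (L.bracket h x y)) := by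
  rw [L.leibniz h ht rfl (by omega) rfl (by omega), map_add, map_smul, φ.map_bracket h,
    φ.map_bracket, φ.map_bracket, M.leibniz h ht rfl (by omega) rfl (by omega), hx, hy]

theorem IsMaurerCartan.d_eq {a : L.V 1} (ha : L.IsMaurerCartan a) (h : (1 : ℤ) + 1 = 2) :
    L.d h a = -((2 : k)⁻¹ • L.bracket h a a) :=
  eq_neg_of_add_eq_zero_left ha

theorem IsMaurerCartan.map_d {a : L.V 1} (ha : L.IsMaurerCartan a)
    (φ : GradedLie.Hom L.toGradedLie M.toGradedLie) (hb : M.IsMaurerCartan (φ.f 1 a))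
    (h : (1 : ℤ) + 1 = 2) : φ.f 2 (L.d h a) = M.d h (φ.f 1 a) := by
  rw [ha.d_eq, hb.d_eq, map_neg, map_smul, φ.map_bracket]

variable [CharZero k]

/-- The endpoints and the element of degree `0` of a gauge determine the differential of the
latter. -/
theorem IsGauge.map_d {x : L.V 0} {a b : L.V 1} (hx : L.IsGauge x a b) (hM : M.IsComplete)
    (φ : GradedLie.Hom L.toGradedLie M.toGradedLie)
    (hy : M.IsGauge (φ.f 0 x) (φ.f 1 a) (φ.f 1 b)) (h : (0 : ℤ) + 1 = 1) :
    φ.f 1 (L.d h x) = M.d h (φ.f 0 x) := by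
  obtain ⟨c, c0, hc, -, hcs⟩ := hx
  obtain ⟨e, e0, he, -, hes⟩ := hy
  -- The image of the first flow and the second flow share both endpoints, and their difference
  -- solves the linear flow equation with source φ(dx) - d(φx).
  refine sub_eq_zero.1 (hM.eq_zero_of_flow (φ.f 0 x) _ (fun n => φ.f 1 (c n) - e n) ?_ ?_ ?_)
  · rw [c0, e0, sub_self]
  · intro n
    rw [smul_sub, he, ← map_smul, hc, map_sub, φ.map_bracket, map_sub]
    split_ifs
    · abel
    · rw [map_zero]; abel
  · intro N
    obtain ⟨K, hK⟩ := hcs N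
    obtain ⟨K', hK'⟩ := hes N
    refine ⟨max K K', fun n hn => ?_⟩
    have h1 := φ.map_mem_F (hK n (le_trans (le_max_left _ _) hn))
    have h2 := hK' n (le_trans (le_max_right _ _) hn)
    rw [map_sub] at h1
    have h3 := sub_mem h1 h2
    rw [sub_sub_sub_cancel_right, map_sum, ← Finset.sum_sub_distrib] at h3
    exact h3

/-- The curvatures of the coefficients of a gauge flow satisfy the linear flow equation. -/
theorem curvature_flow (x : L.V 0) (c : ℕ → L.V 1)
    (hc : ∀ n : ℕ, ((n + 1 : ℕ) : k) • c (n + 1) =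
      (if n = 0 then L.d (zero_add 1) x else 0) - L.bracket (zero_add 1) x (c n))
    (h2 : (1 : ℤ) + 1 = 2) (n : ℕ) :
    ((n + 1 : ℕ) : k) • (L.d h2 (c (n + 1)) + (2 : k)⁻¹ •
      ∑ ij ∈ Finset.HasAntidiagonal.antidiagonal (n + 1), L.bracket h2 (c ij.1) (c ij.2)) =
    (if n = 0 then L.d h2 (L.d (zero_add 1) x) else 0) - L.bracket (zero_add 2) x
      (L.d h2 (c n) + (2 : k)⁻¹ •
        ∑ ij ∈ Finset.HasAntidiagonal.antidiagonal n, L.bracket h2 (c ij.1) (c ij.2)) := by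
  have two : (2 : k) ≠ 0 := two_ne_zero
  set u := L.d (zero_add 1) x with hu
  have hd : ((n + 1 : ℕ) : k) • L.d h2 (c (n + 1)) = (if n = 0 then L.d h2 u else 0) -
      (L.bracket h2 u (c n) + L.bracket (zero_add 2) x (L.d h2 (c n))) := by
    rw [← map_smul, hc, map_sub, L.leibniz _ h2 (zero_add 1) h2 h2 (zero_add 2), sgn_zero,
      one_smul]
    split_ifs <;> simp [hu]
  have swap : ∀ f : ℕ → L.V 1, ∑ ij ∈ Finset.HasAntidiagonal.antidiagonal n,
      L.bracket h2 (c ij.1) (f ij.2) = ∑ ij ∈ Finset.HasAntidiagonal.antidiagonal n,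
      L.bracket h2 (f ij.1) (c ij.2) := by
    intro f
    rw [← Finset.Nat.sum_antidiagonal_swap]
    exact Finset.sum_congr rfl fun ij _ => GradedLie.bracket_one_comm h2 _ _
  -- This is the product rule [α, α]' = 2 [α', α] on coefficients: the weight n + 1 splits as i + j,
  -- and symmetry of the bracket in degree 1 identifies the two halves.
  have hsum : ((n + 1 : ℕ) : k) • ∑ ij ∈ Finset.HasAntidiagonal.antidiagonal (n + 1),
      L.bracket h2 (c ij.1) (c ij.2) = (2 : k) •
      ∑ ij ∈ Finset.HasAntidiagonal.antidiagonal n,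
        L.bracket h2 (((ij.1 + 1 : ℕ) : k) • c (ij.1 + 1)) (c ij.2) := by
    have e : ((n + 1 : ℕ) : k) • ∑ ij ∈ Finset.HasAntidiagonal.antidiagonal (n + 1),
        L.bracket h2 (c ij.1) (c ij.2) =
        ∑ ij ∈ Finset.HasAntidiagonal.antidiagonal (n + 1),
          L.bracket h2 ((ij.1 : k) • c ij.1) (c ij.2) +
        ∑ ij ∈ Finset.HasAntidiagonal.antidiagonal (n + 1),
          L.bracket h2 (c ij.1) ((ij.2 : k) • c ij.2) := by
      rw [Finset.smul_sum, ← Finset.sum_add_distrib]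
      refine Finset.sum_congr rfl fun ij hij => ?_
      rw [← Finset.HasAntidiagonal.mem_antidiagonal.1 hij, Nat.cast_add, add_smul, map_smul,
        map_smul, LinearMap.smul_apply]
    rw [e, Finset.Nat.sum_antidiagonal_succ, Finset.Nat.sum_antidiagonal_succ', two_smul,
      swap fun j => ((j + 1 : ℕ) : k) • c (j + 1)]
    simp
  have hbr : ∑ ij ∈ Finset.HasAntidiagonal.antidiagonal n,
      L.bracket h2 (((ij.1 + 1 : ℕ) : k) • c (ij.1 + 1)) (c ij.2) = L.bracket h2 u (c n) -
      ∑ ij ∈ Finset.HasAntidiagonal.antidiagonal n,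
        L.bracket h2 (L.bracket (zero_add 1) x (c ij.1)) (c ij.2) := by
    rw [Finset.sum_congr rfl fun ij _ => by rw [hc, map_sub, LinearMap.sub_apply],
      Finset.sum_sub_distrib, Finset.sum_eq_single (0, n)]
    · simp
    · rintro ⟨i, j⟩ hij hne
      have := Finset.HasAntidiagonal.mem_antidiagonal.1 hij
      rw [if_neg, map_zero, LinearMap.zero_apply]
      rintro rfl
      exact hne (Prod.ext rfl (by simpa using this))
    · intro h; exact (h (Finset.HasAntidiagonal.mem_antidiagonal.2 (zero_add n))).elim
  -- The Jacobi identity gives [x, [α, α]] = 2 [[x, α], α], which matches the quadratic term of the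
  -- flow; the terms [dx, α] from d(α') and from [α', α] cancel.
  have hjac : L.bracket (zero_add 2) x (∑ ij ∈ Finset.HasAntidiagonal.antidiagonal n,
      L.bracket h2 (c ij.1) (c ij.2)) = (2 : k) • ∑ ij ∈ Finset.HasAntidiagonal.antidiagonal n,
        L.bracket h2 (L.bracket (zero_add 1) x (c ij.1)) (c ij.2) := by
    rw [map_sum, Finset.sum_congr rfl fun ij _ => L.jacobi h2 (zero_add 2) (zero_add 1) h2
      (zero_add 1) h2 x (c ij.1) (c ij.2), Finset.sum_add_distrib, two_smul, zero_mul, sgn_zero]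
    simp only [one_smul]
    rw [swap fun j => L.bracket (zero_add 1) x (c j)]
  rw [smul_add, hd, smul_comm, hsum, hbr, map_add, map_smul, hjac, smul_smul, smul_smul,
    inv_mul_cancel₀ two, one_smul, one_smul]
  abel

/-- A gauge between Maurer--Cartan elements is killed by the square of the differential. -/
theorem IsGauge.d_d_eq_zero {x : L.V 0} {a b : L.V 1} (hx : L.IsGauge x a b) (hL : L.IsComplete)
    (ha : L.IsMaurerCartan a) (hb : L.IsMaurerCartan b) (h1 : (0 : ℤ) + 1 = 1)
    (h2 : (1 : ℤ) + 1 = 2) : L.d h2 (L.d h1 x) = 0 := by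
  obtain ⟨c, c0, hc, hc0, hcs⟩ := hx
  refine hL.eq_zero_of_flow x _ (fun n => L.d h2 (c n) + (2 : k)⁻¹ •
    ∑ ij ∈ Finset.HasAntidiagonal.antidiagonal n, L.bracket h2 (c ij.1) (c ij.2)) ?_
    (curvature_flow x c hc h2) ?_
  · simp only [Finset.Nat.antidiagonal_zero, Finset.sum_singleton, c0]
    exact ha
  · intro N
    obtain ⟨K, hK⟩ := hc0 N
    obtain ⟨K', hK'⟩ := hcs N
    -- When i + j ≥ 2K, one of the two indices is at least K, so the terms outside the triangle lie
    -- in F_N.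
    refine ⟨max (2 * K) K', fun n hn => ?_⟩
    have h3 := hK' n (le_trans (le_max_right _ _) hn)
    have hn' : 2 * K ≤ n := le_trans (le_max_left _ _) hn
    set S := ∑ m ∈ Finset.range n, c m with hS
    have e1 := sum_square_sub_sum_antidiagonal_mem (L.F N 2)
      (fun i j => L.bracket h2 (c i) (c j)) n fun i j hij => by
        rcases le_or_gt K i with h | h
        · exact GradedLie.bracket_mem_F_left h2 _ (hK i h)
        · exact GradedLie.bracket_mem_F_right h2 _ (hK j (by omega))
    have e2 : ∑ i ∈ Finset.range n, ∑ j ∈ Finset.range n, L.bracket h2 (c i) (c j) =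
        L.bracket h2 S S := by
      simp only [hS, map_sum, LinearMap.sum_apply]
      exact Finset.sum_comm
    rw [e2] at e1
    have e3 := GradedLie.bracket_mem_F_left h2 S h3
    have e4 := GradedLie.bracket_mem_F_right h2 b h3
    have e5 := DerLie.d_mem_F h2 h3
    rw [Finset.sum_add_distrib, ← Finset.smul_sum, ← map_sum, ← hS]
    -- Since [S - b, S] + [b, S - b] = [S, S] - [b, b], the summed curvature differs from db + ½[b,
    -- b] = 0 by an element of F_N.
    have e6 := add_mem e5 (Submodule.smul_mem _ (2 : k)⁻¹ (sub_mem (add_mem e3 e4) e1))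
    convert e6 using 1
    simp only [map_sub, LinearMap.sub_apply, smul_add, smul_sub]
    rw [hb.d_eq h2]
    abel

end DerLie

/-! ### Reduction of d² = 0 and of compatibility with d to the generators. -/

section Free

variable {k : Type u} [Field k] {I : Type} [Fintype I] (deg : I → ℤ)
  (D : ∀ i, (freeLie k deg).V (deg i + 1))

/-- The map d² preserves the filtration and its kernel is closed under brackets, so its vanishing
spreads from the generators by density. -/
theorem freeDerLie_isDGLie
    (hD : ∀ i, (freeDerLie deg D).d (rfl : deg i + 1 + 1 = _)
      ((freeDerLie deg D).d rfl (lieGen k deg i)) = 0) :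
    (freeDerLie deg D).IsDGLie := by
  intro p q r h h' x
  subst h h'
  refine eq_zero_of_eq_zero_on_gen deg (freeLie_isComplete deg) (σ := fun p => p + 1 + 1)
    (fun p => (freeDerLie deg D).d rfl ∘ₗ (freeDerLie deg D).d rfl)
    (fun i => ?_) (fun {p q r} h x z hx hz => ?_) (fun {n p x} hx => ?_) x
  · exact hD i
  · exact DerLie.d_d_bracket_eq_zero (L := freeDerLie deg D) h rfl rfl x z hx hz
  · exact DerLie.d_mem_F (L := freeDerLie deg D) rfl
      (DerLie.d_mem_F (L := freeDerLie deg D) rfl hx)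

theorem hom_map_d {M : DerLie k} (hM : M.IsComplete)
    (φ : GradedLie.Hom (freeLie k deg) M.toGradedLie)
    (hφ : ∀ i, φ.f (deg i + 1) ((freeDerLie deg D).d rfl (lieGen k deg i)) =
      M.d rfl (φ.f _ (lieGen k deg i))) {p q : ℤ} (h : p + 1 = q)
    (x : (freeLie k deg).V p) : φ.f q ((freeDerLie deg D).d h x) = M.d h (φ.f p x) := by
  subst h
  let δ : ∀ p, (freeLie k deg).V p →ₗ[k] (freeLie k deg).V (p + 1) :=
    fun p => (freeDerLie deg D).d rfl
  refine sub_eq_zero.1 (eq_zero_of_eq_zero_on_gen deg hM (σ := fun p => p + 1)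
    (fun p => φ.f (p + 1) ∘ₗ δ p - M.d rfl ∘ₗ φ.f p)
    (fun i => ?_) (fun {p q r} h x z hx hz => ?_) (fun {n p x} hx => ?_) x)
  · exact sub_eq_zero.2 (hφ i)
  · exact sub_eq_zero.2 (DerLie.map_d_bracket (L := freeDerLie deg D) φ h rfl x z
      (sub_eq_zero.1 hx) (sub_eq_zero.1 hz))
  · exact sub_mem (φ.map_mem_F (DerLie.d_mem_F (L := freeDerLie deg D) rfl hx))
      (DerLie.d_mem_F (L := M) rfl (φ.map_mem_F hx))

end Free

/-- Differentiating da = -½[a, a] leaves a multiple of [a, [a, a]], and for odd a the Jacobi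
identity reads 3 [a, [a, a]] = 0. -/
theorem DerLie.IsMaurerCartan.d_d_eq_zero {k : Type u} [Field k] [CharZero k] {L : DerLie k}
    {a : L.V 1} (ha : L.IsMaurerCartan a) (h₁ : (1 : ℤ) + 1 = 2) (h₂ : (2 : ℤ) + 1 = 3) :
    L.d h₂ (L.d h₁ a) = 0 := by
  have h₂' : (1 : ℤ) + 2 = 3 := by norm_num
  have hj := L.jacobi h₁ h₂' h₁ h₂ h₁ h₂' a a a
  have hs : L.bracket h₂ (L.bracket h₁ a a) a = -L.bracket h₂' a (L.bracket h₁ a a) := by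
    rw [L.antisymm h₂ h₂', show (2 : ℤ) * 1 = 1 + 1 by norm_num, sgn_add, sgn_mul_self, one_smul]
  rw [hs, mul_one, sgn_one, neg_smul, one_smul] at hj
  have h3 : (3 : k) • L.bracket h₂' a (L.bracket h₁ a a) = 0 := by
    rw [show (3 : k) = 1 + 1 + 1 by norm_num, add_smul, add_smul, one_smul]
    nth_rewrite 1 [hj]
    abel
  have h0 := (smul_eq_zero.1 h3).resolve_left (by norm_num)
  rw [ha.d_eq, map_neg, map_smul, L.leibniz h₁ h₂ h₁ h₂ h₁ h₂', ha.d_eq]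
  simp [hs, h0]

/-! ### Vertex generators of the cobar construction. -/

namespace Contraction

variable {k : Type u} [Field k] {Ω : CDGA k} {I : Type} [Fintype I] [DecidableEq I]
  (c : Contraction Ω I)

/-- Every tree with a vertex ends in the homotopy, which the projection kills; only leaves are seen.
-/
theorem p_treeForm (i : I) (T : FreeMagma I) :
    c.p i (c.treeForm T) = if T = .of i then 1 else 0 := by
  cases T with
  | of j =>
    change c.p i (c.e j) = _
    rw [c.p_e]
    by_cases h : i = j
    · subst h; simp
    · rw [if_neg h, if_neg]
      intro h'
      cases h'
      exact h rfl
  | mul s t =>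
    change c.p i (_ • c.h _) = _
    rw [map_smul, c.p_h, smul_zero, if_neg]
    intro h
    cases h

/-- If the `i`-th coordinate of the projection is an augmentation, then the generator dual to `i`
is a Maurer--Cartan element. -/
theorem genD_eq_of_mul (i : I) (hi : c.deg i = 0)
    (hmul : ∀ a b, c.p i (a * b) = c.p i a * c.p i b) (hd : ∀ j, c.p i (Ω.d (c.e j)) = 0)
    (h : c.genDeg i + c.genDeg i = c.genDeg i + 1) :
    c.genD i = -((2 : k)⁻¹ • (freeLie k c.genDeg).bracket h (lieGen k c.genDeg i)
      (lieGen k c.genDeg i)) := by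
  have hdeg : c.genDeg i = 1 := by rw [genDeg, hi, sub_zero]
  -- Multiplicativity splits the coefficient into the coordinates of the two branches, and these are
  -- nonzero only when both branches are the leaf i.
  have h0 : ∀ T, T ≠ FreeMagma.of i * FreeMagma.of i → c.treeCoeff i T = 0 := by
    intro T hT
    cases T with
    | of j =>
      change -(_ * c.p i (Ω.d (c.e j))) = 0
      rw [hd, mul_zero, neg_zero]
    | mul s t =>
      change -(_ * c.p i (c.treeForm s * c.treeForm t)) = 0
      rw [hmul, p_treeForm, p_treeForm]
      split_ifs with h1 h2
      · subst h1 h2; exact absurd rfl hT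
      all_goals simp
  have h1 : c.treeCoeff i (FreeMagma.of i * FreeMagma.of i) = -(2 : k)⁻¹ := by
    change -(2⁻¹ * sgn k ((1 - c.genDeg i) * c.genDeg i) *
      c.p i (c.treeForm (.of i) * c.treeForm (.of i))) = _
    rw [hmul, p_treeForm, hdeg]
    simp
  have hb : ((freeLie k c.genDeg).bracket h (lieGen k c.genDeg i) (lieGen k c.genDeg i)).1 =
      PowerSeries.monomial 2 (treeLie k c.genDeg (FreeMagma.of i * FreeMagma.of i)) := by
    rw [freeLie_bracket_coe]
    change PowerSeries.monomial 1 (FreeAlgebra.ι k i) * PowerSeries.monomial 1 (FreeAlgebra.ι k i) -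
      _ • (PowerSeries.monomial 1 (FreeAlgebra.ι k i) *
        PowerSeries.monomial 1 (FreeAlgebra.ι k i)) = _
    rw [PowerSeries.monomial_mul_monomial, smul_monomial, ← map_sub]
    rfl
  refine Subtype.ext ?_
  change _ = -((2 : k)⁻¹ • ((freeLie k c.genDeg).bracket h (lieGen k c.genDeg i)
      (lieGen k c.genDeg i)).1)
  rw [hb]
  ext1 m
  change PowerSeries.coeff m (PowerSeries.mk fun n =>
    ∑ t ∈ trees I n, c.treeCoeff i t • treeLie k c.genDeg t) = _
  rw [PowerSeries.coeff_mk, map_neg, coeff_smul', PowerSeries.coeff_monomial,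
    ← neg_smul, ← h1]
  split_ifs with hm
  · subst hm
    rw [Finset.sum_eq_single (FreeMagma.of i * FreeMagma.of i)]
    · intro T _ hT
      rw [h0 T hT, zero_smul]
    · intro h'; exact absurd (mem_trees.2 rfl) h'
  · rw [smul_zero]
    refine Finset.sum_eq_zero fun T hT => ?_
    rw [h0 T, zero_smul]
    rintro rfl
    exact hm (mem_trees.1 hT).symm

end Contraction

/-! ### Combs: trees with a distinguished leaf at the root. -/

/-- Sums over the trees with `n + 2` leaves of functions supported on the trees in which a branch
at the root is the leaf `e`. -/
theorem sum_trees_eq_of_leaf {I : Type} [Fintype I] [DecidableEq I] {N : Type*}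
    [AddCommMonoid N] (e : I) (f : FreeMagma I → N)
    (h : ∀ s t, s ≠ .of e → t ≠ .of e → f (s * t) = 0) (he : f (.of e * .of e) = 0) (n : ℕ) :
    ∑ T ∈ trees I (n + 2), f T =
      ∑ t ∈ trees I (n + 1), (f (.of e * t) + f (t * .of e)) := by
  classical
  have inj1 : Function.Injective fun t : FreeMagma I => FreeMagma.of e * t := by
    intro s t hst
    cases hst
    rfl
  have inj2 : Function.Injective fun t : FreeMagma I => t * FreeMagma.of e := by
    intro s t hst
    cases hst
    rfl
  rw [Finset.sum_add_distrib, ← Finset.sum_image (f := f) inj1.injOn,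
    ← Finset.sum_image (f := f) inj2.injOn, ← Finset.sum_union_inter]
  -- The tree with two leaves e is the only one counted from both sides; `he` makes the double count
  -- harmless.
  have hi : ∑ T ∈ (trees I (n + 1)).image (fun t => FreeMagma.of e * t) ∩
      (trees I (n + 1)).image (fun t => t * FreeMagma.of e), f T = 0 := by
    refine Finset.sum_eq_zero fun T hT => ?_
    obtain ⟨h1, h2⟩ := Finset.mem_inter.1 hT
    obtain ⟨s, -, rfl⟩ := Finset.mem_image.1 h1
    obtain ⟨t, -, hst⟩ := Finset.mem_image.1 h2
    cases hst
    exact he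
  rw [hi, add_zero]
  symm
  refine Finset.sum_subset (fun T hT => ?_) fun T hT hT' => ?_
  · rcases Finset.mem_union.1 hT with hT | hT <;> obtain ⟨t, ht, rfl⟩ := Finset.mem_image.1 hT <;>
      rw [mem_trees] at ht ⊢
    · change 1 + t.length = _; omega
    · change t.length + 1 = _; omega
  · rw [mem_trees] at hT
    cases T with
    | of j => simp [FreeMagma.length] at hT
    | mul s t =>
      have hl : s.length + t.length = n + 2 := hT
      refine h s t ?_ ?_
      · rintro rfl
        have : (FreeMagma.of e).length = 1 := rfl
        exact hT' (Finset.mem_union_left _ (Finset.mem_image_of_mem _ (mem_trees.2 (by omega))))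
      · rintro rfl
        have : (FreeMagma.of e).length = 1 := rfl
        exact hT' (Finset.mem_union_right _ (Finset.mem_image.2 ⟨s, mem_trees.2 (by omega), rfl⟩))

section Interval

open Polynomial

variable (k : Type u) [Field k]

/-- This absorbs the factor ½ per vertex once the two planar orders of a vertex are added. -/
theorem add_half_smul [NeZero (2 : k)] {N : Type*} [AddCommGroup N] [Module k N] (x : k) (v : N) :
    ((2 : k)⁻¹ * x) • v + ((2 : k)⁻¹ * x) • v = x • v := by
  have : (2 : k) ≠ 0 := two_ne_zero
  rw [← add_smul]
  congr 1
  field_simp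
  ring

theorem sum_trees_one {N : Type u} [AddCommMonoid N] (f : FreeMagma Face1 → N) :
    ∑ T ∈ trees Face1 1, f T = f (.of .v0) + f (.of .v1) + f (.of .e01) := by
  rw [trees, Finset.sum_image, Face1.sum_eq]
  intro i _ j _ h
  cases h
  rfl

theorem mc0_isMaurerCartan_gen : (mc0 k).IsMaurerCartan (mc0Gen k) := by
  have h := (dupont0 k).genD_eq_of_mul () rfl (fun a b => rfl) (fun j => rfl) rfl
  exact add_eq_zero_iff_eq_neg.2
    ((freeDerLie_d_gen (dupont0 k).genDeg (dupont0 k).genD ()).trans h)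

variable [CharZero k]

/-! ### Forms and coefficients of labelled trees on the interval. -/

/-- The `0`-form part of the form of a labelled tree on the interval. -/
noncomputable def fstForm (T : FreeMagma Face1) : k[X] :=
  fstL k ((dupont1 k).treeForm T)

/-- The `1`-form part of the form of a labelled tree on the interval. -/
noncomputable def sndForm (T : FreeMagma Face1) : k[X] :=
  sndL k ((dupont1 k).treeForm T)

/-- The `0`-form that Dupont's homotopy assigns to `f dt`. -/
noncomputable def homotopyPoly : k[X] →ₗ[k] k[X] :=
  antideriv k - (LinearMap.toSpanSingleton k k[X] X) ∘ₗ leval 1 ∘ₗ antideriv k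

/-- The homotopy produces 0-forms, so dt can only come from a bare leaf. This is why only combs
contribute to λ and to the 0-form part. -/
theorem sndForm_eq_zero {T : FreeMagma Face1} (hT : T ≠ .of .e01) : sndForm k T = 0 := by
  cases T with
  | of j =>
    cases j
    · rfl
    · rfl
    · exact absurd rfl hT
  | mul s t =>
    exact (map_smul (sndL k) _ _).trans (smul_zero _)

theorem sndForm_e01 : sndForm k (.of .e01) = 1 := rfl

theorem fstForm_e01 : fstForm k (.of .e01) = 0 := rfl

theorem fstForm_eq_zero {T : FreeMagma Face1} (hT : treeDeg (dupont1 k).genDeg T ≠ 1) :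
    fstForm k T = 0 :=
  ((dupont1 k).treeForm_mem T).1 (by omega)

theorem snd_treeForm_mul (s t : FreeMagma Face1) :
    TrivSqZeroExt.snd ((dupont1 k).treeForm s * (dupont1 k).treeForm t : DualNumber k[X]) =
      fstForm k s * sndForm k t + sndForm k s * fstForm k t :=
  DualNumber.snd_mul _ _

theorem fstForm_mul (s t : FreeMagma Face1) : fstForm k (s * t) =
    -((2 : k)⁻¹ * sgn k ((1 - treeDeg (dupont1 k).genDeg s) * treeDeg (dupont1 k).genDeg t +
        (treeDeg (dupont1 k).genDeg s + treeDeg (dupont1 k).genDeg t))) •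
      homotopyPoly k (fstForm k s * sndForm k t + sndForm k s * fstForm k t) := by
  rw [← snd_treeForm_mul]
  rfl

theorem treeCoeff_e01_mul (s t : FreeMagma Face1) : (dupont1 k).treeCoeff .e01 (s * t) =
    -((2 : k)⁻¹ * sgn k ((1 - treeDeg (dupont1 k).genDeg s) * treeDeg (dupont1 k).genDeg t) *
      (antideriv k (fstForm k s * sndForm k t + sndForm k s * fstForm k t)).eval 1) := by
  rw [← snd_treeForm_mul]
  rfl

theorem leaf_mul_formula (t : FreeMagma Face1) :
    fstForm k (.of .e01) * sndForm k t + sndForm k (.of .e01) * fstForm k t = fstForm k t := by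
  rw [sndForm_e01, fstForm_e01]; ring

theorem mul_leaf_formula (t : FreeMagma Face1) :
    fstForm k t * sndForm k (.of .e01) + sndForm k t * fstForm k (.of .e01) = fstForm k t := by
  rw [sndForm_e01, fstForm_e01]; ring

theorem treeDeg_e01 : treeDeg (dupont1 k).genDeg (.of .e01) = 0 := rfl

theorem treeLie_leaf_mul (t : FreeMagma Face1) :
    treeLie k (dupont1 k).genDeg (.of .e01 * t) =
      gradedComm k (FreeAlgebra k Face1) 0 (FreeAlgebra.ι k .e01)
        (treeLie k (dupont1 k).genDeg t) := by
  rw [treeLie_mul, treeDeg_e01, zero_mul]; rfl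

theorem treeLie_mul_leaf (t : FreeMagma Face1) :
    treeLie k (dupont1 k).genDeg (t * .of .e01) =
      -gradedComm k (FreeAlgebra k Face1) 0 (FreeAlgebra.ι k .e01)
        (treeLie k (dupont1 k).genDeg t) := by
  rw [treeLie_mul, treeDeg_e01, mul_zero, gradedComm_apply, sgn_zero, one_smul, one_smul, neg_sub]
  rfl

/-- Unless t has degree 1, its 0-form part is zero. In degree 1 the two planar orders have form
coefficients -½ and +½ and Lie elements [λ, t] and -[λ, t], so they add up instead of cancelling. -/
theorem fstForm_leaf_add (ℓ : Module.Dual k k[X]) (t : FreeMagma Face1) :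
    ℓ (fstForm k (.of .e01 * t)) • treeLie k (dupont1 k).genDeg (.of .e01 * t) +
      ℓ (fstForm k (t * .of .e01)) • treeLie k (dupont1 k).genDeg (t * .of .e01) =
    -gradedComm k (FreeAlgebra k Face1) 0 (FreeAlgebra.ι k .e01)
      (ℓ (homotopyPoly k (fstForm k t)) • treeLie k (dupont1 k).genDeg t) := by
  rw [fstForm_mul, fstForm_mul, leaf_mul_formula, mul_leaf_formula, treeLie_leaf_mul,
    treeLie_mul_leaf, treeDeg_e01]
  by_cases ht : treeDeg (dupont1 k).genDeg t = 1
  · rw [ht, map_smul, ← add_half_smul k (ℓ (homotopyPoly k (fstForm k t)))]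
    have h2 : sgn k 2 = 1 := by rw [show (2 : ℤ) = 1 + 1 by norm_num, sgn_add, sgn_mul_self]
    simp [h2]
  · simp [fstForm_eq_zero k ht]

/-- The count is the same as for the forms, but without the sign of the homotopy at the root, so the
result is +[λ, ∫₀¹]. -/
theorem treeCoeff_leaf_add (t : FreeMagma Face1) :
    (dupont1 k).treeCoeff .e01 (.of .e01 * t) • treeLie k (dupont1 k).genDeg (.of .e01 * t) +
      (dupont1 k).treeCoeff .e01 (t * .of .e01) • treeLie k (dupont1 k).genDeg (t * .of .e01) =
    gradedComm k (FreeAlgebra k Face1) 0 (FreeAlgebra.ι k .e01)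
      ((antideriv k (fstForm k t)).eval 1 • treeLie k (dupont1 k).genDeg t) := by
  rw [treeCoeff_e01_mul, treeCoeff_e01_mul, leaf_mul_formula, mul_leaf_formula, treeLie_leaf_mul,
    treeLie_mul_leaf, treeDeg_e01]
  by_cases ht : treeDeg (dupont1 k).genDeg t = 1
  · rw [ht, ← add_half_smul k ((antideriv k (fstForm k t)).eval 1)]
    simp
  · simp [fstForm_eq_zero k ht]

/-! ### The generating series A(t) of 0-forms and the differential of λ. -/

/-- The coefficients of word length `n` of the `0`-form part of the sum over all trees, evaluated
by a linear functional. -/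
noncomputable def treeSum (n : ℕ) : Module.Dual k k[X] →ₗ[k] FreeAlgebra k Face1 :=
  ∑ T ∈ trees Face1 n, (Module.Dual.eval k k[X] (fstForm k T)).smulRight
    (treeLie k (dupont1 k).genDeg T)

theorem treeSum_apply (n : ℕ) (ℓ : Module.Dual k k[X]) : treeSum k n ℓ =
    ∑ T ∈ trees Face1 n, ℓ (fstForm k T) • treeLie k (dupont1 k).genDeg T := by
  simp [treeSum]

theorem treeSum_zero (ℓ : Module.Dual k k[X]) : treeSum k 0 ℓ = 0 := by
  rw [treeSum_apply, trees, Finset.sum_empty]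

theorem treeSum_one (ℓ : Module.Dual k k[X]) : treeSum k 1 ℓ =
    ℓ (1 - X) • FreeAlgebra.ι k .v0 + ℓ X • FreeAlgebra.ι k .v1 := by
  rw [treeSum_apply, sum_trees_one, fstForm_e01, map_zero, zero_smul, add_zero]
  rfl

/-- This is A = (1 - t) α₀ + t α₁ - [λ, hA] in word length at least 2. Polynomial variables are
tested by functionals, so the homotopy acts by precomposition. -/
theorem treeSum_succ (n : ℕ) (ℓ : Module.Dual k k[X]) : treeSum k (n + 2) ℓ =
    -gradedComm k (FreeAlgebra k Face1) 0 (FreeAlgebra.ι k .e01)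
      (treeSum k (n + 1) (ℓ ∘ₗ homotopyPoly k)) := by
  rw [treeSum_apply, sum_trees_eq_of_leaf .e01, Finset.sum_congr rfl fun t _ =>
    fstForm_leaf_add k ℓ t, Finset.sum_neg_distrib, ← map_sum, treeSum_apply]
  · rfl
  · intro s t hs ht
    rw [fstForm_mul, sndForm_eq_zero k hs, sndForm_eq_zero k ht]
    simp
  · rw [fstForm_mul, fstForm_e01]
    simp

theorem treeSum_mem (n : ℕ) (ℓ : Module.Dual k k[X]) :
    treeSum k n ℓ ∈ liePoly k (dupont1 k).genDeg n 1 := by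
  rw [treeSum_apply]
  refine Submodule.sum_mem _ fun T hT => ?_
  by_cases h : treeDeg (dupont1 k).genDeg T = 1
  · exact Submodule.smul_mem _ _ (Submodule.subset_span ⟨T, mem_trees.1 hT, h, rfl⟩)
  · rw [fstForm_eq_zero k h, map_zero, zero_smul]; exact zero_mem _

/-- The `0`-form part of the sum over all trees, evaluated by a linear functional. -/
noncomputable def formSeries (ℓ : Module.Dual k k[X]) : (mc1 k).V 1 :=
  ⟨PowerSeries.mk fun n => treeSum k n ℓ, fun n => by
    rw [PowerSeries.coeff_mk]; exact treeSum_mem k n ℓ⟩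

theorem coeff_formSeries (ℓ : Module.Dual k k[X]) (n : ℕ) :
    PowerSeries.coeff n (formSeries k ℓ).1 = treeSum k n ℓ := by
  change PowerSeries.coeff n (PowerSeries.mk fun n => treeSum k n ℓ) = _
  rw [PowerSeries.coeff_mk]

theorem coeff_genD (i : Face1) (n : ℕ) : PowerSeries.coeff n ((dupont1 k).genD i).1 =
    ∑ T ∈ trees Face1 n, (dupont1 k).treeCoeff i T • treeLie k (dupont1 k).genDeg T := by
  rw [← PowerSeries.coeff_mk n fun n =>
    ∑ T ∈ trees Face1 n, (dupont1 k).treeCoeff i T • treeLie k (dupont1 k).genDeg T]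
  rfl

theorem treeCoeff_e01_of (j : Face1) : (dupont1 k).treeCoeff .e01 (.of j) =
    -(sgn k ((dupont1 k).genDeg j) *
      ((basicForm k j).fst.eval 1 - (basicForm k j).fst.eval 0)) := by
  change -(_ * (antideriv k (derivative (basicForm k j).fst)).eval 1) = _
  rw [antideriv_derivative]
  simp

theorem coeff_genD_e01_one : PowerSeries.coeff 1 ((dupont1 k).genD .e01).1 =
    FreeAlgebra.ι k .v1 - FreeAlgebra.ι k .v0 := by
  have d0 : (dupont1 k).genDeg .v0 = 1 := rfl
  have d1 : (dupont1 k).genDeg .v1 = 1 := rfl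
  rw [coeff_genD, sum_trees_one, treeCoeff_e01_of, treeCoeff_e01_of, treeCoeff_e01_of, d0, d1]
  simp [basicForm]
  abel

theorem coeff_genD_e01_succ (n : ℕ) : PowerSeries.coeff (n + 2) ((dupont1 k).genD .e01).1 =
    gradedComm k (FreeAlgebra k Face1) 0 (FreeAlgebra.ι k .e01)
      (treeSum k (n + 1) (leval 1 ∘ₗ antideriv k)) := by
  rw [coeff_genD, sum_trees_eq_of_leaf .e01, Finset.sum_congr rfl fun t _ =>
    treeCoeff_leaf_add k t, ← map_sum, treeSum_apply]
  · rfl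
  · intro s t hs ht
    rw [treeCoeff_e01_mul, sndForm_eq_zero k hs, sndForm_eq_zero k ht]
    simp
  · rw [treeCoeff_e01_mul, fstForm_e01]
    simp

/-! ### The flow equation and the gauge from α₀ to α₁. -/

theorem coeff_bracket_gen01_zero (F : (mc1 k).V 1) (h : (0 : ℤ) + 1 = 1) :
    PowerSeries.coeff 0 ((mc1 k).bracket h (mc1Gen01 k) F).1 = 0 :=
  coeff_zero_lieHat _ ((mc1 k).bracket h (mc1Gen01 k) F)

theorem coeff_bracket_gen01_succ (F : (mc1 k).V 1) (h : (0 : ℤ) + 1 = 1) (n : ℕ) :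
    PowerSeries.coeff (n + 1) ((mc1 k).bracket h (mc1Gen01 k) F).1 =
      gradedComm k (FreeAlgebra k Face1) 0 (FreeAlgebra.ι k .e01) (PowerSeries.coeff n F.1) := by
  change PowerSeries.coeff (n + 1) (PowerSeries.monomial 1 (FreeAlgebra.ι k Face1.e01) * F.1 -
    sgn k (0 * 1) • (F.1 * PowerSeries.monomial 1 (FreeAlgebra.ι k Face1.e01))) = _
  rw [map_sub, coeff_smul', coeff_succ_monomial_one_mul, coeff_succ_mul_monomial_one]
  rfl

/-- This is (hf)' = f - ∫₀¹ f on coefficients; the constant ∫₀¹ f appears only for n = 0. -/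
theorem lcoeff_succ_comp_homotopyPoly (n : ℕ) :
    ((n + 1 : ℕ) : k) • (lcoeff k (n + 1) ∘ₗ homotopyPoly k) =
      lcoeff k n - (if n = 0 then leval 1 ∘ₗ antideriv k else 0) := by
  refine LinearMap.ext fun f => ?_
  have h1 : ((n + 1 : ℕ) : k) * (antideriv k f).coeff (n + 1) = f.coeff n := by
    conv_rhs => rw [← derivative_antideriv k f, coeff_derivative]
    push_cast
    ring
  simp only [homotopyPoly, LinearMap.smul_apply, LinearMap.comp_apply, LinearMap.sub_apply,
    lcoeff_apply, coeff_sub, smul_eq_mul, mul_sub, h1, LinearMap.toSpanSingleton_apply,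
    coeff_smul, coeff_X, leval_apply]
  rcases n with _ | n <;> simp

theorem mc1_d_gen01 (h : (0 : ℤ) + 1 = 1) :
    (mc1 k).d h (mc1Gen01 k) = (dupont1 k).genD .e01 :=
  freeDerLie_d_gen (dupont1 k).genDeg (dupont1 k).genD .e01

theorem mc1_ext {p : ℤ} {F G : (mc1 k).V p}
    (h : ∀ n, PowerSeries.coeff n F.1 = PowerSeries.coeff n G.1) : F = G :=
  Subtype.ext (PowerSeries.ext h)

/-- In word length 1 both sides come from the derivative α₁ - α₀ of (1 - t) α₀ + t α₁. In higher
length, differentiating -[λ, hA] gives -[λ, A] plus [λ, ∫₀¹ A], and the latter is the matching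
component of dλ. -/
theorem flow_formSeries (n : ℕ) (h : (0 : ℤ) + 1 = 1) :
    ((n + 1 : ℕ) : k) • formSeries k (lcoeff k (n + 1)) =
      (if n = 0 then (mc1 k).d h (mc1Gen01 k) else 0) -
        (mc1 k).bracket h (mc1Gen01 k) (formSeries k (lcoeff k n)) := by
  have e : ∀ (u v w : (mc1 k).V 1), (∀ m, ((n + 1 : ℕ) : k) • PowerSeries.coeff m u.1 =
      (if n = 0 then PowerSeries.coeff m v.1 else 0) - PowerSeries.coeff m w.1) →
      ((n + 1 : ℕ) : k) • u = (if n = 0 then v else 0) - w := by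
    intro u v w huv
    refine mc1_ext k fun m => (huv m).trans ?_
    split_ifs
    · exact (map_sub (PowerSeries.coeff m) v.1 w.1).symm
    · exact (congrArg (· - _) (map_zero (PowerSeries.coeff m)).symm).trans
        (map_sub (PowerSeries.coeff m) 0 w.1).symm
  refine e _ _ _ fun m => ?_
  rw [mc1_d_gen01]
  match m with
  | 0 =>
    rw [coeff_formSeries, coeff_bracket_gen01_zero, treeSum_zero,
      coeff_zero_lieHat _ ((dupont1 k).genD .e01)]
    simp
  | 1 =>
    rw [coeff_formSeries, coeff_bracket_gen01_succ, coeff_formSeries, treeSum_zero, treeSum_one,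
      coeff_genD_e01_one]
    rcases n with _ | n
    · simp [coeff_one]; abel
    · simp [coeff_one, coeff_X]
  | m + 2 =>
    rw [coeff_formSeries, coeff_bracket_gen01_succ, coeff_formSeries, treeSum_succ,
      coeff_genD_e01_succ, smul_neg, ← map_smul, ← map_smul, lcoeff_succ_comp_homotopyPoly,
      map_sub, map_sub]
    split_ifs <;> simp

/-- Only finitely many trees have fewer than N leaves, so modulo F_N the series A is a polynomial in
t; the witness exceeds all degrees that occur. -/
theorem formSeries_lcoeff_mem_F (N : ℕ) :
    ∃ K : ℕ, ∀ n ≥ K, formSeries k (lcoeff k n) ∈ (mc1 k).F N 1 := by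
  refine ⟨((Finset.range N).sup fun m => (trees Face1 m).sup fun T => (fstForm k T).natDegree) + 1,
    fun n hn => mem_F_of_coeff_eq_zero _ N _ fun m hm => ?_⟩
  refine (coeff_formSeries k _ m).trans ?_
  rw [treeSum_apply]
  refine Finset.sum_eq_zero fun T hT => ?_
  have h1 : (fstForm k T).natDegree ≤ (trees Face1 m).sup fun T => (fstForm k T).natDegree :=
    Finset.le_sup (f := fun T => (fstForm k T).natDegree) hT
  have h2 := Finset.le_sup (f := fun m => (trees Face1 m).sup fun T => (fstForm k T).natDegree)
    (Finset.mem_range.2 hm)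
  rw [lcoeff_apply, coeff_eq_zero_of_natDegree_lt, zero_smul]
  exact lt_of_le_of_lt (h1.trans h2) (by omega)

theorem sum_formSeries (ℓ : ℕ → Module.Dual k k[X]) (n : ℕ) :
    ∑ m ∈ Finset.range n, formSeries k (ℓ m) = formSeries k (∑ m ∈ Finset.range n, ℓ m) := by
  refine mc1_ext k fun j => ?_
  rw [coeff_formSeries, map_sum]
  have : (∑ m ∈ Finset.range n, formSeries k (ℓ m)).1 =
      ∑ m ∈ Finset.range n, (formSeries k (ℓ m)).1 := AddSubmonoidClass.coe_finsetSum _ _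
  rw [this, map_sum]
  exact Finset.sum_congr rfl fun m _ => coeff_formSeries k _ j

theorem formSeries_sub_mem_F (N : ℕ) : ∃ K : ℕ, ∀ n ≥ K,
    (∑ m ∈ Finset.range n, formSeries k (lcoeff k m)) - formSeries k (leval 1) ∈
      (mc1 k).F N 1 := by
  refine ⟨((Finset.range N).sup fun m => (trees Face1 m).sup fun T => (fstForm k T).natDegree) + 1,
    fun n hn => mem_F_of_coeff_eq_zero _ N _ fun m hm => ?_⟩
  rw [sum_formSeries]
  refine (map_sub (PowerSeries.coeff m) (formSeries k _).1 (formSeries k _).1).trans ?_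
  rw [coeff_formSeries, coeff_formSeries, sub_eq_zero, treeSum_apply, treeSum_apply]
  refine Finset.sum_congr rfl fun T hT => ?_
  have h1 : (fstForm k T).natDegree ≤ (trees Face1 m).sup fun T => (fstForm k T).natDegree :=
    Finset.le_sup (f := fun T => (fstForm k T).natDegree) hT
  have h2 := Finset.le_sup (f := fun m => (trees Face1 m).sup fun T => (fstForm k T).natDegree)
    (Finset.mem_range.2 hm)
  -- Beyond the degree, the sum of the coefficients is the value at t = 1.
  rw [leval_apply, eval_eq_sum_range' (lt_of_le_of_lt (h1.trans h2) hn)]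
  simp

/-- The `0`-form part of the sum over all trees has the generators as its values at the
vertices. -/
theorem formSeries_leval_zero : formSeries k (leval 0) = mc1Gen0 k := by
  refine mc1_ext k fun m => ?_
  change _ = PowerSeries.coeff m (PowerSeries.monomial 1 (FreeAlgebra.ι k Face1.v0))
  rw [coeff_formSeries, PowerSeries.coeff_monomial]
  match m with
  | 0 => rw [treeSum_zero, if_neg (by norm_num)]
  | 1 => rw [treeSum_one]; simp
  | m + 2 =>
    rw [treeSum_succ, if_neg (by omega)]
    -- Dupont's homotopy vanishes at the vertices, so only word length 1 survives evaluation there.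
    have : leval (R := k) 0 ∘ₗ homotopyPoly k = 0 := by
      ext f
      simp [homotopyPoly, antideriv_eval_zero]
    rw [this, map_zero, map_zero, neg_zero]

theorem formSeries_leval_one : formSeries k (leval 1) = mc1Gen1 k := by
  refine mc1_ext k fun m => ?_
  change _ = PowerSeries.coeff m (PowerSeries.monomial 1 (FreeAlgebra.ι k Face1.v1))
  rw [coeff_formSeries, PowerSeries.coeff_monomial]
  match m with
  | 0 => rw [treeSum_zero, if_neg (by norm_num)]
  | 1 => rw [treeSum_one]; simp
  | m + 2 =>
    rw [treeSum_succ, if_neg (by omega)]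
    have : leval (R := k) 1 ∘ₗ homotopyPoly k = 0 := by
      ext f
      simp [homotopyPoly]
    rw [this, map_zero, map_zero, neg_zero]

theorem mc1_isGauge : (mc1 k).IsGauge (mc1Gen01 k) (mc1Gen0 k) (mc1Gen1 k) := by
  refine ⟨fun n => formSeries k (lcoeff k n), ?_, fun n => flow_formSeries k n _,
    formSeries_lcoeff_mem_F k, ?_⟩
  · have : lcoeff k 0 = leval 0 := by
      ext n
      simp [coeff_zero_eq_eval_zero]
    simp only [this, formSeries_leval_zero]
  · rw [← formSeries_leval_one]
    exact formSeries_sub_mem_F k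

/-- Evaluation at a vertex is multiplicative on forms and kills differentials, which are 1-forms
here. -/
theorem mc1_isMaurerCartan_gen0 : (mc1 k).IsMaurerCartan (mc1Gen0 k) := by
  have h := (dupont1 k).genD_eq_of_mul .v0 rfl
    (fun a b => eval_mul (R := k) (p := TrivSqZeroExt.fst (a : DualNumber k[X])))
    (fun j => by
      change eval 0 (0 : k[X]) = 0
      simp) rfl
  exact add_eq_zero_iff_eq_neg.2
    ((freeDerLie_d_gen (dupont1 k).genDeg (dupont1 k).genD .v0).trans h)

theorem mc1_isMaurerCartan_gen1 : (mc1 k).IsMaurerCartan (mc1Gen1 k) := by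
  have h := (dupont1 k).genD_eq_of_mul .v1 rfl
    (fun a b => eval_mul (R := k) (p := TrivSqZeroExt.fst (a : DualNumber k[X])))
    (fun j => by
      change eval 1 (0 : k[X]) = 0
      simp) rfl
  exact add_eq_zero_iff_eq_neg.2
    ((freeDerLie_d_gen (dupont1 k).genDeg (dupont1 k).genD .v1).trans h)

/-! ### Assembly of the two universal characterisations. -/

theorem mc0_isFreeOnMaurerCartan : (mc0 k).IsFreeOnMaurerCartan (mc0Gen k) := by
  refine ⟨freeDerLie_isDGLie _ _ fun i => ?_, freeLie_isFreeCompleteOn k (dupont0 k).genDeg,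
    mc0_isMaurerCartan_gen k⟩
  exact (mc0_isMaurerCartan_gen k).d_d_eq_zero rfl rfl

theorem mc1_isFreeCompleteOn : (mc1 k).IsFreeCompleteOn DerLie.LSGen.deg
    ((mc1 k).lsFamily (mc1Gen0 k) (mc1Gen1 k) (mc1Gen01 k)) := by
  obtain ⟨hc, hu⟩ := freeLie_isFreeCompleteOn k (dupont1 k).genDeg
  refine ⟨hc, fun M hM y => ?_⟩
  let y' : ∀ i, M.V ((dupont1 k).genDeg i) := fun i => match i with
    | .v0 => y .a
    | .v1 => y .b
    | .e01 => y .x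
  obtain ⟨φ, hφ, huniq⟩ := hu M hM y'
  refine ⟨φ, fun i => ?_, fun χ hχ => huniq χ fun i => ?_⟩
  · cases i
    exacts [hφ .v0, hφ .v1, hφ .e01]
  · cases i
    exacts [hχ .a, hχ .b, hχ .x]

theorem mc1_isLawrenceSullivan :
    (mc1 k).IsLawrenceSullivan (mc1Gen0 k) (mc1Gen1 k) (mc1Gen01 k) := by
  refine ⟨freeDerLie_isDGLie _ _ fun i => ?_, mc1_isFreeCompleteOn k, mc1_isMaurerCartan_gen0 k,
    mc1_isMaurerCartan_gen1 k, mc1_isGauge k⟩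
  cases i
  · exact (mc1_isMaurerCartan_gen0 k).d_d_eq_zero rfl rfl
  · exact (mc1_isMaurerCartan_gen1 k).d_d_eq_zero rfl rfl
  · exact (mc1_isGauge k).d_d_eq_zero (mc1_isFreeCompleteOn k).1 (mc1_isMaurerCartan_gen0 k)
      (mc1_isMaurerCartan_gen1 k) rfl rfl

theorem exists_iso_mc0 (L : DerLie k) (a : L.V 1) (hL : L.IsFreeOnMaurerCartan a) :
    ∃ φ : DerLie.Iso (mc0 k) L, φ.f 1 (mc0Gen k) = a := by
  obtain ⟨-, hfree, hMC⟩ := hL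
  have h0 := mc0_isFreeOnMaurerCartan k
  obtain ⟨φ, hφ, -⟩ := h0.2.1.2 L.toGradedLie hfree.1 fun _ => a
  have ha : φ.f 1 (mc0Gen k) = a := hφ ()
  refine ⟨{ toHom := φ
            bijective := h0.2.1.bijective hfree φ hφ
            map_d := hom_map_d _ _ hfree.1 φ fun i => ?_ }, ha⟩
  exact h0.2.2.map_d φ (ha ▸ hMC) rfl

/-- Freeness of both sides supplies a bijective morphism. Compatibility with d is needed only on the
generators: at the vertices the Maurer–Cartan equation prescribes d, on λ the gauge condition does.
-/
theorem exists_iso_mc1 (L : DerLie k) (a b : L.V 1) (x : L.V 0)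
    (hL : L.IsLawrenceSullivan a b x) :
    ∃ φ : DerLie.Iso (mc1 k) L, φ.f 1 (mc1Gen0 k) = a ∧ φ.f 1 (mc1Gen1 k) = b ∧
      φ.f 0 (mc1Gen01 k) = x := by
  obtain ⟨-, hfree, hMCa, hMCb, hg⟩ := hL
  have h1 := mc1_isFreeCompleteOn k
  obtain ⟨φ, hφ, -⟩ := h1.2 L.toGradedLie hfree.1 (L.lsFamily a b x)
  have ha : φ.f 1 (mc1Gen0 k) = a := hφ .a
  have hb : φ.f 1 (mc1Gen1 k) = b := hφ .b
  have hx : φ.f 0 (mc1Gen01 k) = x := hφ .x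
  refine ⟨{ toHom := φ
            bijective := h1.bijective hfree φ hφ
            map_d := hom_map_d _ _ hfree.1 φ fun i => ?_ }, ha, hb, hx⟩
  cases i
  · exact (mc1_isMaurerCartan_gen0 k).map_d φ (ha ▸ hMCa) rfl
  · exact (mc1_isMaurerCartan_gen1 k).map_d φ (hb ▸ hMCb) rfl
  · exact (mc1_isGauge k).map_d hfree.1 φ (ha ▸ hb ▸ hx ▸ hg) rfl

end Interval

end LieMC

theorem proposition5p4 (k : Type u) [Field k] [CharZero k] :
    ((LieMC.mc0 k).IsFreeOnMaurerCartan (LieMC.mc0Gen k) ∧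
      ∀ (L : LieMC.DerLie k) (a : L.V 1), L.IsFreeOnMaurerCartan a →
        ∃ φ : LieMC.DerLie.Iso (LieMC.mc0 k) L, φ.f 1 (LieMC.mc0Gen k) = a) ∧
    ((LieMC.mc1 k).IsLawrenceSullivan (LieMC.mc1Gen0 k) (LieMC.mc1Gen1 k) (LieMC.mc1Gen01 k) ∧
      ∀ (L : LieMC.DerLie k) (a b : L.V 1) (x : L.V 0), L.IsLawrenceSullivan a b x →
        ∃ φ : LieMC.DerLie.Iso (LieMC.mc1 k) L, φ.f 1 (LieMC.mc1Gen0 k) = a ∧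
          φ.f 1 (LieMC.mc1Gen1 k) = b ∧ φ.f 0 (LieMC.mc1Gen01 k) = x) :=
  ⟨⟨LieMC.mc0_isFreeOnMaurerCartan k, LieMC.exists_iso_mc0 k⟩,
    LieMC.mc1_isLawrenceSullivan k, LieMC.exists_iso_mc1 k⟩
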